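/- All rings are commutative and Noetherian, and all modules are finitely generated. For a local ring $R$ with total ring of fractions $Q$, an $R$-module $C$ is *torsion* if each element of $C$ is killed by some non-zero-divisor of $R$, it is *torsion-free* if no nonzero element of $C$ is killed by a non-zero-divisor of $R$, it *has rank* if $Q\otimes_R C$ is a free $Q$-module, and it is *maximal Cohen–Macaulay* if $C=0$ or $\operatorname{depth}_R C=\dim R$. **Proposition.** Let $R$ be a $d$-dimensional Gorenstein local ring and let $M$ be an $R$-module. Then the following conditions are equivalent: (i) For every torsion $R$-module $C$ and every $n\ge d$: if $\operatorname{Tor}_n^R(M,C)=0$, then $\operatorname{Tor}_i^R(M,C)=0$ for all $i\ge n$. (ii) For every maximal Cohen–Macaulay $R$-module $C$ that has rank and every $n\ge d$: if $\operatorname{Tor}_n^R(M,C)=0$, then $\operatorname{Tor}_i^R(M,C)=0$ for all $i\ge n$. (iii) For every $R$-module $C$ that has rank and every $n\ge d$: if $\operatorname{Tor}_n^R(M,C)=0$, then $\operatorname{Tor}_i^R(M,C)=0$ for all $i\ge n$. Call a pair $(M,C)$ of $R$-modules *Tor-rigid* if, for every $r\ge 1$, $\operatorname{Tor}_r^R(M,C)=0$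 implies $\operatorname{Tor}_j^R(M,C)=0$ for all $j\ge r$, and call $M$ *Tor-rigid* if $(M,C)$ is Tor-rigid for every $R$-module $C$. **Corollary.** If moreover $d=1$ and $R$ is a domain, then the following conditions are equivalent: (a) $M$ is Tor-rigid; (b) $(M,C)$ is Tor-rigid for each torsion (or equivalently, finite length) $R$-module $C$; (c) $(M,C)$ is Tor-rigid for each torsion-free (or equivalently, maximal Cohen–Macaulay) $R$-module $C$. Here "or equivalently" means that, over such a ring, an $R$-module is torsion if and only if it has finite length, and torsion-free if and only if it is maximal Cohen–Macaulay. -/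

import Mathlib

open CategoryTheory CategoryTheory.Limits
open scoped TensorProduct

universe u

/-- A Noetherian local ring is Gorenstein if it has finite injective dimension as a module over
itself. -/
def IsGorensteinLocalRing (R : Type u) [CommRing R] [IsLocalRing R] : Prop :=
  IsNoetherianRing R ∧ ∃ n : ℕ, HasInjectiveDimensionLE (ModuleCat.of R R) n

/-- `TorVanishes R M C n` says that `Tor_n^R(M, C) = 0`. -/
def TorVanishes (R : Type u) [CommRing R] (M C : Type u) [AddCommGroup M] [Module R M]
    [AddCommGroup C] [Module R C] (n : ℕ) : Prop :=
  IsZero (((Tor (ModuleCat.{u} R) n).obj (ModuleCat.of R M)).obj (ModuleCat.of R C))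

/-- A module `C` has rank if `Q ⊗ C` is a free `Q`-module of some finite rank `r`, where `Q` is the
total ring of fractions of `R`, that is, the localization of `R` at its non-zero-divisors. -/
def ModuleHasRank (R : Type u) [CommRing R] (C : Type u) [AddCommGroup C] [Module R C] : Prop :=
  ∃ r : ℕ, Nonempty ((FractionRing R ⊗[R] C) ≃ₗ[FractionRing R] (Fin r → FractionRing R))

/-- The depth of a nonzero finitely generated module `C` over a local ring: the supremum of the
lengths of the `C`-regular sequences in the maximal ideal. -/
noncomputable def moduleDepth (R : Type u) [CommRing R] [IsLocalRing R] (C : Type u)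
    [AddCommGroup C] [Module R C] : ℕ∞ :=
  ⨆ (rs : List R) (_ : ∀ x ∈ rs, x ∈ IsLocalRing.maximalIdeal R)
    (_ : RingTheory.Sequence.IsRegular C rs), (rs.length : ℕ∞)

/-- A finitely generated module over a local ring is maximal Cohen-Macaulay if it is zero or its
depth equals the Krull dimension of the ring. -/
def IsMaximalCohenMacaulay (R : Type u) [CommRing R] [IsLocalRing R] (C : Type u)
    [AddCommGroup C] [Module R C] : Prop :=
  Module.Finite R C ∧ (Subsingleton C ∨ (moduleDepth R C : WithBot ℕ∞) = ringKrullDim R)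

/-- The pair `(M, C)` is `n`-Tor-rigid: whenever `Tor_i(M, C) = 0` for `n` consecutive values
`i = r, …, r + n - 1` with `r ≥ 1`, one has `Tor_j(M, C) = 0` for all `j ≥ r`. -/
def IsTorRigidPair (R : Type u) [CommRing R] (n : ℕ) (M C : Type u) [AddCommGroup M] [Module R M]
    [AddCommGroup C] [Module R C] : Prop :=
  ∀ r : ℕ, 1 ≤ r → (∀ i, r ≤ i → i < r + n → TorVanishes R M C i) →
    ∀ j, r ≤ j → TorVanishes R M C j

/-- A module `M` is Tor-rigid if `(M, C)` is `1`-Tor-rigid for each finitely generated module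
`C`. -/
def IsTorRigid (R : Type u) [CommRing R] (M : Type u) [AddCommGroup M] [Module R M] : Prop :=
  ∀ (C : Type u) [AddCommGroup C] [Module R C] [Module.Finite R C], IsTorRigidPair R 1 M C

/-! Gorenstein duality replaces an arbitrary module of rank by a maximal Cohen–Macaulay one, and the
latter by a torsion module, while keeping track of Tor.

Call `X` perpendicular if `Ext^i(X, R) = 0` for all `i > 0`. Finite self-injective dimension makes
duals of perpendicular modules perpendicular and the modules themselves reflexive. Hence such an `X`
embeds in a finite free module so that linear forms extend, and the cokernel is again perpendicular
(`ExtVanishesAbove.exists_cosyzygy`). Iterating this transfers regular sequences from `R` to `X`. As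
`R` has a regular sequence of length `d`, perpendicular modules are maximal Cohen–Macaulay. Moreover
`Ext^i(C, R) = 0` for every `C` and `i > d`, because the self-injective dimension is at most the
dimension (`FiniteSelfInjectiveDimension.exists_isRegular`).

Given `C` of rank, take `d` syzygies and then `d` cosyzygies, with every kernel and cokernel of
rank. The resulting perpendicular `X` has the same Tor vanishing as `C` in degrees above `d`. In
degree `d` vanishing still passes from `C` to `X`, because linear forms extend
(`ExtVanishesAbove.exists_replacement`). So rigidity for maximal Cohen–Macaulay modules of rank
gives it for all modules of rank. A perpendicular `X` of rank `r` also embeds in `R^r` with torsion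
cokernel `T`, and `Tor_{i+1}(M, T)` vanishes exactly when `Tor_i(M, X)` does, for `i ≥ 1`. This
reduces everything to torsion modules, which themselves have rank 0.

For the corollary, every finitely generated module over a domain has rank, and `d = 1` turns the
range `n ≥ d` into the range `r ≥ 1` of Tor-rigidity. -/

/-! ### Vanishing of Ext into the ring along short exact sequences. -/

section ExtVanishing

variable {R : Type u} [CommRing R]

/-- `ExtVanishes R N i` says that `Ext^i_R(N, R) = 0`. -/
def ExtVanishes (R : Type u) [CommRing R] (N : Type u) [AddCommGroup N] [Module R N] (i : ℕ) :
    Prop :=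
  Subsingleton (Abelian.Ext.{u} (ModuleCat.of R N) (ModuleCat.of R R) i)

variable {N₁ N₂ N₃ : Type u} [AddCommGroup N₁] [Module R N₁] [AddCommGroup N₂] [Module R N₂]
  [AddCommGroup N₃] [Module R N₃]

/-- The short exact sequence in `ModuleCat R` attached to a short exact sequence of modules. -/
theorem moduleCat_shortExact {f : N₁ →ₗ[R] N₂} {g : N₂ →ₗ[R] N₃} (hf : Function.Injective f)
    (hg : Function.Surjective g) (hfg : Function.Exact f g) :
    (ModuleCat.shortComplexOfCompEqZero f g hfg.linearMap_comp_eq_zero).ShortExact where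
  exact := ModuleCat.shortComplex_exact _ hfg
  mono_f := (ModuleCat.mono_iff_injective _).mpr hf
  epi_g := (ModuleCat.epi_iff_surjective _).mpr hg

theorem ExtVanishes.middle {f : N₁ →ₗ[R] N₂} {g : N₂ →ₗ[R] N₃} (hf : Function.Injective f)
    (hg : Function.Surjective g) (hfg : Function.Exact f g) {i : ℕ}
    (h₁ : ExtVanishes R N₁ i) (h₃ : ExtVanishes R N₃ i) : ExtVanishes R N₂ i := by
  have S := moduleCat_shortExact hf hg hfg
  refine subsingleton_of_forall_eq 0 fun x ↦ ?_
  obtain ⟨y, rfl⟩ := Abelian.Ext.contravariant_sequence_exact₂ S _ x (h₁.elim _ _)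
  rw [h₃.elim y 0, Abelian.Ext.comp_zero]

theorem ExtVanishes.right {f : N₁ →ₗ[R] N₂} {g : N₂ →ₗ[R] N₃} (hf : Function.Injective f)
    (hg : Function.Surjective g) (hfg : Function.Exact f g) {i : ℕ}
    (h₁ : ExtVanishes R N₁ i) (h₂ : ExtVanishes R N₂ (i + 1)) : ExtVanishes R N₃ (i + 1) := by
  have S := moduleCat_shortExact hf hg hfg
  refine subsingleton_of_forall_eq 0 fun x ↦ ?_
  obtain ⟨y, rfl⟩ := Abelian.Ext.contravariant_sequence_exact₃ S _ x (h₂.elim _ _) (add_comm 1 i)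
  rw [h₁.elim y 0, Abelian.Ext.comp_zero]

theorem ExtVanishes.left {f : N₁ →ₗ[R] N₂} {g : N₂ →ₗ[R] N₃} (hf : Function.Injective f)
    (hg : Function.Surjective g) (hfg : Function.Exact f g) {i : ℕ}
    (h₂ : ExtVanishes R N₂ i) (h₃ : ExtVanishes R N₃ (i + 1)) : ExtVanishes R N₁ i := by
  have S := moduleCat_shortExact hf hg hfg
  refine subsingleton_of_forall_eq 0 fun x ↦ ?_
  obtain ⟨y, rfl⟩ := Abelian.Ext.contravariant_sequence_exact₁ S _ x (add_comm 1 i) (h₃.elim _ _)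
  rw [h₂.elim y 0, Abelian.Ext.comp_zero]

theorem ExtVanishes.of_subsingleton [Subsingleton N₁] (i : ℕ) : ExtVanishes R N₁ i :=
  subsingleton_of_forall_eq 0 fun x ↦ by
    rw [← x.mk₀_id_comp, (ModuleCat.isZero_of_subsingleton _).eq_zero_of_src (𝟙 _),
      Abelian.Ext.mk₀_zero, Abelian.Ext.zero_comp]

theorem ExtVanishes.of_linearEquiv (e : N₁ ≃ₗ[R] N₂) {i : ℕ} (h : ExtVanishes R N₁ i) :
    ExtVanishes R N₂ i :=
  ExtVanishes.middle (N₃ := PUnit.{u + 1}) (g := 0) e.injective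
    (Function.surjective_to_subsingleton _) ((e.exact_zero_iff_surjective _).2 e.surjective) h
    (ExtVanishes.of_subsingleton i)

theorem ExtVanishes.of_projective [Module.Projective R N₁] (i : ℕ) : ExtVanishes R N₁ (i + 1) := by
  have : Projective (ModuleCat.of R N₁) := (IsProjective.iff_projective _).mp inferInstance
  exact subsingleton_of_forall_eq 0 fun x ↦ Abelian.Ext.eq_zero_of_projective x

/-- If `Ext^1(N₃, R) = 0` then linear forms extend from `N₁` to `N₂`. -/
theorem ExtVanishes.exists_extend {f : N₁ →ₗ[R] N₂} {g : N₂ →ₗ[R] N₃} (hf : Function.Injective f)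
    (hg : Function.Surjective g) (hfg : Function.Exact f g) (h : ExtVanishes R N₃ 1)
    (φ : N₁ →ₗ[R] R) : ∃ ψ : N₂ →ₗ[R] R, ψ ∘ₗ f = φ := by
  have S := moduleCat_shortExact hf hg hfg
  obtain ⟨y, hy⟩ := Abelian.Ext.contravariant_sequence_exact₁ S (ModuleCat.of R R)
    (Abelian.Ext.mk₀ (ModuleCat.ofHom φ)) (add_comm 1 0) (h.elim _ _)
  obtain ⟨ψ, rfl⟩ := Abelian.Ext.homEquiv₀.symm.surjective y
  simp only [Abelian.Ext.homEquiv₀_symm_apply, Abelian.Ext.mk₀_comp_mk₀] at hy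
  refine ⟨ψ.hom, ?_⟩
  have : ModuleCat.ofHom f ≫ ψ = ModuleCat.ofHom φ :=
    Abelian.Ext.homEquiv₀.symm.injective (by simpa using hy)
  exact congrArg ModuleCat.Hom.hom this

/-- If linear forms extend from `N₁` to the projective module `N₂`, then `Ext^1(N₃, R) = 0`. -/
theorem ExtVanishes.of_extend [Module.Projective R N₂] {f : N₁ →ₗ[R] N₂} {g : N₂ →ₗ[R] N₃}
    (hf : Function.Injective f)
    (hg : Function.Surjective g) (hfg : Function.Exact f g)
    (h : ∀ φ : N₁ →ₗ[R] R, ∃ ψ : N₂ →ₗ[R] R, ψ ∘ₗ f = φ) : ExtVanishes R N₃ 1 := by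
  have S := moduleCat_shortExact hf hg hfg
  refine subsingleton_of_forall_eq 0 fun x ↦ ?_
  obtain ⟨y, rfl⟩ := Abelian.Ext.contravariant_sequence_exact₃ S _ x
    ((ExtVanishes.of_projective (N₁ := N₂) 0).elim _ _) (add_comm 1 0)
  obtain ⟨φ, rfl⟩ := Abelian.Ext.homEquiv₀.symm.surjective y
  obtain ⟨ψ, hψ⟩ := h φ.hom
  have : φ = (ModuleCat.ofHom f) ≫ ModuleCat.ofHom ψ := by
    ext1; exact hψ.symm
  simp only [Abelian.Ext.homEquiv₀_symm_apply]
  rw [this, ← Abelian.Ext.mk₀_comp_mk₀, ← Abelian.Ext.comp_assoc_of_second_deg_zero]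
  erw [S.extClass_comp]
  simp

end ExtVanishing

/-! ### Duality for modules without positive Ext into the ring. -/

section Perp

variable {R : Type u} [CommRing R]

/-- A finitely generated module `X` with `Ext^i(X, R) = 0` for all `i > k`. -/
structure ExtVanishesAbove (R : Type u) [CommRing R] (k : ℕ) (X : Type u) [AddCommGroup X]
    [Module R X] : Prop where
  finite : Module.Finite R X
  ext : ∀ i, k < i → ExtVanishes R X i

variable (R) in
/-- All finitely generated modules satisfy `Ext^i(X, R) = 0` for `i > n`. -/
def FiniteSelfInjectiveDimension (n : ℕ) : Prop :=
  ∀ (X : Type u) [AddCommGroup X] [Module R X] [Module.Finite R X], ExtVanishesAbove R n X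

variable {X K F : Type u} [AddCommGroup X] [Module R X] [AddCommGroup K] [Module R K]
  [AddCommGroup F] [Module R F]

/-- Dualizing a short exact sequence whose last term has vanishing `Ext^1`. -/
theorem dual_shortExact {f : K →ₗ[R] F} {g : F →ₗ[R] X} (hf : Function.Injective f)
    (hg : Function.Surjective g) (hfg : Function.Exact f g) (h : ExtVanishes R X 1) :
    Function.Injective (Module.Dual.transpose (R := R) g) ∧
      Function.Surjective (Module.Dual.transpose (R := R) f) ∧
      Function.Exact (Module.Dual.transpose (R := R) g) (Module.Dual.transpose (R := R) f) := by
  refine ⟨fun a b hab ↦ ?_, fun φ ↦ h.exists_extend hf hg hfg φ, fun φ ↦ ⟨fun hφ ↦ ?_, ?_⟩⟩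
  · ext x
    obtain ⟨y, rfl⟩ := hg x
    exact LinearMap.congr_fun hab y
  · have hle : LinearMap.ker g ≤ LinearMap.ker φ := fun y hy ↦ by
      obtain ⟨z, rfl⟩ := (hfg y).mp hy
      exact LinearMap.congr_fun hφ z
    refine ⟨(LinearMap.ker g).liftQ φ hle ∘ₗ (g.quotKerEquivOfSurjective hg).symm, ?_⟩
    ext y
    have : (g.quotKerEquivOfSurjective hg).symm (g y) = Submodule.Quotient.mk y := by
      rw [LinearEquiv.symm_apply_eq]; rfl
    simp [Module.Dual.transpose_apply, this]
  · rintro ⟨ψ, rfl⟩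
    ext z
    simp [Module.Dual.transpose_apply, hfg.apply_apply_eq_zero]

theorem ExtVanishesAbove.syzygy [IsNoetherianRing R] [Module.Finite R F] [Module.Projective R F]
    {k : ℕ} {f : K →ₗ[R] F} {g : F →ₗ[R] X} (hf : Function.Injective f)
    (hg : Function.Surjective g) (hfg : Function.Exact f g) (h : ExtVanishesAbove R (k + 1) X) :
    ExtVanishesAbove R k K where
  finite := Module.Finite.of_injective f hf
  ext i hi := by
    obtain ⟨i, rfl⟩ : ∃ j, i = j + 1 := ⟨i - 1, by omega⟩
    exact ExtVanishes.left hf hg hfg (.of_projective _) (h.ext _ (by omega))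

theorem ExtVanishesAbove.mono {k l : ℕ} (hkl : k ≤ l) (h : ExtVanishesAbove R k X) :
    ExtVanishesAbove R l X := ⟨h.finite, fun i hi ↦ h.ext i (by omega)⟩

/-- The dual of a module with vanishing positive `Ext` into `R` has the same property. -/
theorem ExtVanishesAbove.dual [IsNoetherianRing R] {n : ℕ} (hR : FiniteSelfInjectiveDimension R n)
    (h : ExtVanishesAbove R 0 X) : ExtVanishesAbove R 0 (Module.Dual R X) := by
  -- Dualizing `0 → K → F → X → 0` shows that `Ext^{i+1}(K*, R) = 0` forces `Ext^i(X*, R) = 0`.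
  -- Since `K` is in the same class, `j` such steps raise the degree above `n`.
  have key : ∀ (j i : ℕ), n < j + i → 0 < i → ∀ (X : Type u) [AddCommGroup X] [Module R X],
      ExtVanishesAbove R 0 X → ExtVanishes R (Module.Dual R X) i := by
    intro j
    induction j with
    | zero =>
      intro i hi _ X _ _ hX
      have := hX.finite
      exact (hR (Module.Dual R X)).ext i (by omega)
    | succ j ih =>
      intro i hi hi0 X _ _ hX
      have := hX.finite
      obtain ⟨m, p, hp⟩ := Module.Finite.exists_fin' R X
      have hK := (hX.mono (Nat.zero_le 1)).syzygy (LinearMap.ker p).injective_subtype hp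
        (LinearMap.exact_subtype_ker_map p)
      obtain ⟨h1, h2, h3⟩ := dual_shortExact (LinearMap.ker p).injective_subtype hp
        (LinearMap.exact_subtype_ker_map p) (hX.ext 1 one_pos)
      obtain ⟨i, rfl⟩ : ∃ j, i = j + 1 := ⟨i - 1, by omega⟩
      exact ExtVanishes.left h1 h2 h3 (.of_projective _) (ih _ (by omega) (by omega) _ hK)
  have := h.finite
  exact ⟨inferInstance, fun i hi ↦ key n i (by omega) hi X h⟩

/-- Linear forms on the dual of a module with vanishing positive `Ext` are evaluations. -/
theorem ExtVanishesAbove.eval_surjective [IsNoetherianRing R] {n : ℕ}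
    (hR : FiniteSelfInjectiveDimension R n) (h : ExtVanishesAbove R 0 X) :
    Function.Surjective (Module.Dual.eval R X) := by
  intro ψ
  have := h.finite
  obtain ⟨m, p, hp⟩ := Module.Finite.exists_fin' R X
  have hK := (h.mono (Nat.zero_le 1)).syzygy (LinearMap.ker p).injective_subtype hp
    (LinearMap.exact_subtype_ker_map p)
  obtain ⟨h1, h2, h3⟩ := dual_shortExact (LinearMap.ker p).injective_subtype hp
    (LinearMap.exact_subtype_ker_map p) (h.ext 1 one_pos)
  -- `Ext^1(K*, R) = 0` extends the form on `X*` to `F*`, where every form is an evaluation because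
  -- `F` is free.
  obtain ⟨ψ', rfl⟩ := ((hK.dual hR).ext 1 one_pos).exists_extend h1 h2 h3 ψ
  obtain ⟨v, rfl⟩ := (Module.evalEquiv R (Fin m → R)).surjective ψ'
  exact ⟨p v, rfl⟩

/-- A module with vanishing positive `Ext` into `R` is torsionless. -/
theorem ExtVanishesAbove.eval_injective [IsNoetherianRing R] {n : ℕ}
    (hR : FiniteSelfInjectiveDimension R n) (h : ExtVanishesAbove R 0 X) :
    Function.Injective (Module.Dual.eval R X) := by
  rw [injective_iff_map_eq_zero]
  intro x hx
  have := h.finite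
  obtain ⟨m, p, hp⟩ := Module.Finite.exists_fin' R X
  have hK := (h.mono (Nat.zero_le 1)).syzygy (LinearMap.ker p).injective_subtype hp
    (LinearMap.exact_subtype_ker_map p)
  obtain ⟨h1, h2, h3⟩ := dual_shortExact (LinearMap.ker p).injective_subtype hp
    (LinearMap.exact_subtype_ker_map p) (h.ext 1 one_pos)
  obtain ⟨v, rfl⟩ := hp x
  set r := Module.Dual.transpose (R := R) (LinearMap.ker p).subtype
  -- If all forms on `X` kill `p v`, evaluation at `v` factors through `K*`. There it is evaluation
  -- at some `w` in `K`, so `v = w` lies in `K`.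
  have hle : LinearMap.ker r ≤ LinearMap.ker (Module.Dual.eval R (Fin m → R) v) := fun φ hφ ↦ by
    obtain ⟨χ, rfl⟩ := (h3 φ).mp hφ
    exact LinearMap.congr_fun hx χ
  obtain ⟨w, hw⟩ := hK.eval_surjective hR
    ((LinearMap.ker r).liftQ _ hle ∘ₗ (r.quotKerEquivOfSurjective h2).symm)
  have hvw : Module.evalEquiv R (Fin m → R) v = Module.evalEquiv R (Fin m → R) w := by
    ext1 φ
    have h4 : (r.quotKerEquivOfSurjective h2).symm (r φ) = Submodule.Quotient.mk φ := by
      rw [LinearEquiv.symm_apply_eq]; rfl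
    have h5 := LinearMap.congr_fun hw (r φ)
    simp only [LinearMap.comp_apply, LinearEquiv.coe_coe, h4] at h5
    exact h5.symm
  rw [(Module.evalEquiv R (Fin m → R)).injective hvw]
  exact w.2

/-- Over a ring of finite self-injective dimension, a module `X` with `Ext^i(X, R) = 0` for
`i > 0` embeds in a finite free module in such a way that linear forms on `X` extend; the embedding
can be chosen to extend a given map into a finite free module. The cokernel has again the same
vanishing property. -/
theorem ExtVanishesAbove.exists_cosyzygy [IsNoetherianRing R] {n : ℕ}
    (hR : FiniteSelfInjectiveDimension R n) (h : ExtVanishesAbove R 0 X) :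
    ∃ (m : ℕ) (a : X →ₗ[R] (Fin m → R)), ∀ (r : ℕ) (b : X →ₗ[R] (Fin r → R)),
      Function.Injective (b.prod a) ∧ (∀ φ : X →ₗ[R] R, ∃ ψ, ψ ∘ₗ b.prod a = φ) ∧
      ExtVanishesAbove R 0 (((Fin r → R) × (Fin m → R)) ⧸ LinearMap.range (b.prod a)) := by
  have := h.finite
  obtain ⟨m, s, hs⟩ := Module.Finite.exists_fin (R := R) (M := Module.Dual R X)
  -- The coordinates of `a` generate the dual of `X`. This gives injectivity and extension of forms
  -- whatever `b` is.
  refine ⟨m, LinearMap.pi s, fun r b ↦ ?_⟩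
  have hinj : Function.Injective (b.prod (LinearMap.pi s)) := by
    rw [injective_iff_map_eq_zero]
    intro x hx
    refine h.eval_injective hR ?_
    rw [map_zero]
    have hx' : ∀ i, s i x = 0 := fun i ↦ congrFun (congrArg Prod.snd hx) i
    have : (⊤ : Submodule R (Module.Dual R X)) ≤ LinearMap.ker (Module.Dual.eval R X x) := by
      rw [← hs, Submodule.span_le]
      rintro _ ⟨i, rfl⟩
      exact hx' i
    exact LinearMap.ker_eq_top.mp (top_le_iff.mp this)
  have hext : ∀ φ : X →ₗ[R] R, ∃ ψ, ψ ∘ₗ b.prod (LinearMap.pi s) = φ := fun φ ↦ by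
    have hφ : φ ∈ Submodule.span R (Set.range s) := hs ▸ Submodule.mem_top
    obtain ⟨c, rfl⟩ := (Submodule.mem_span_range_iff_exists_fun R).mp hφ
    refine ⟨(∑ i, c i • LinearMap.proj i) ∘ₗ LinearMap.snd _ _ _, ?_⟩
    ext x
    simp
  refine ⟨hinj, hext, inferInstance, fun i hi ↦ ?_⟩
  obtain _ | _ | i := i
  · omega
  · exact ExtVanishes.of_extend hinj (Submodule.mkQ_surjective _)
      (LinearMap.exact_map_mkQ_range _) hext
  · exact ExtVanishes.right hinj (Submodule.mkQ_surjective _)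
      (LinearMap.exact_map_mkQ_range _) (h.ext _ (by omega)) (.of_projective _)

end Perp

/-! ### Bass's argument that dimension is at most self-injective dimension, without localizing. -/

section LocalExt

open scoped Pointwise

variable {R : Type u} [CommRing R]

/-- `ExtVanishesAt R q N i` says that some element outside of `q` annihilates `Ext^i(N, R)`. For
finitely generated `N` over a Noetherian ring and a prime `q` this means `Ext^i(N, R)_q = 0`. -/
def ExtVanishesAt (R : Type u) [CommRing R] (q : Ideal R) (N : Type u) [AddCommGroup N]
    [Module R N] (i : ℕ) : Prop :=
  ∃ s ∉ q, ∀ e : Abelian.Ext.{u} (ModuleCat.of R N) (ModuleCat.of R R) i, s • e = 0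

variable {N N₁ N₂ N₃ : Type u} [AddCommGroup N] [Module R N] [AddCommGroup N₁] [Module R N₁]
  [AddCommGroup N₂] [Module R N₂] [AddCommGroup N₃] [Module R N₃] {q : Ideal R}

theorem ExtVanishes.extVanishesAt (hq : q ≠ ⊤) {i : ℕ} (h : ExtVanishes R N i) :
    ExtVanishesAt R q N i :=
  ⟨1, fun h1 ↦ hq ((Ideal.eq_top_iff_one q).mpr h1), fun _ ↦ h.elim _ _⟩

theorem ExtVanishesAt.extVanishes [IsLocalRing R] {i : ℕ}
    (h : ExtVanishesAt R (IsLocalRing.maximalIdeal R) N i) : ExtVanishes R N i := by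
  obtain ⟨s, hs, h⟩ := h
  have hs : IsUnit s := by simpa using hs
  exact subsingleton_of_forall_eq 0 fun e ↦ (hs.smul_eq_zero).mp (h e)

theorem Ext.smul_eq_mk₀_lsmul_comp {i : ℕ} (r : R)
    (e : Abelian.Ext.{u} (ModuleCat.of R N) (ModuleCat.of R R) i) :
    (Abelian.Ext.mk₀ (ModuleCat.ofHom (LinearMap.lsmul R N r))).comp e (zero_add i) = r • e := by
  have : ModuleCat.ofHom (LinearMap.lsmul R N r) = r • 𝟙 (ModuleCat.of R N) := rfl
  rw [this, Abelian.Ext.mk₀_smul, Abelian.Ext.smul_comp, Abelian.Ext.mk₀_id_comp]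

theorem ExtVanishesAt.of_smul_eq_zero {s : R} (hs : s ∉ q) (h : ∀ x : N, s • x = 0) (i : ℕ) :
    ExtVanishesAt R q N i := by
  refine ⟨s, hs, fun e ↦ ?_⟩
  have h0 : ModuleCat.ofHom (LinearMap.lsmul R N s) = 0 := by ext x; exact h x
  rw [← Ext.smul_eq_mk₀_lsmul_comp, h0, Abelian.Ext.mk₀_zero, Abelian.Ext.zero_comp]

theorem ExtVanishesAt.middle [q.IsPrime] {f : N₁ →ₗ[R] N₂} {g : N₂ →ₗ[R] N₃}
    (hf : Function.Injective f) (hg : Function.Surjective g) (hfg : Function.Exact f g) {i : ℕ}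
    (h₁ : ExtVanishesAt R q N₁ i) (h₃ : ExtVanishesAt R q N₃ i) : ExtVanishesAt R q N₂ i := by
  have S := moduleCat_shortExact hf hg hfg
  obtain ⟨s, hs, h₁⟩ := h₁
  obtain ⟨t, ht, h₃⟩ := h₃
  refine ⟨t * s, fun h ↦ ((‹q.IsPrime›.mem_or_mem h).elim ht hs), fun x ↦ ?_⟩
  obtain ⟨y, hy⟩ := Abelian.Ext.contravariant_sequence_exact₂ S _ (s • x)
    ((Abelian.Ext.comp_smul ..).trans (h₁ _))
  rw [mul_smul, ← hy, ← Abelian.Ext.comp_smul, h₃ y, Abelian.Ext.comp_zero]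

theorem ExtVanishesAt.of_linearEquiv [q.IsPrime] (e : N₁ ≃ₗ[R] N₂) {i : ℕ}
    (h : ExtVanishesAt R q N₁ i) : ExtVanishesAt R q N₂ i :=
  ExtVanishesAt.middle (N₃ := PUnit.{u + 1}) (g := 0) e.injective
    (Function.surjective_to_subsingleton _) ((e.exact_zero_iff_surjective _).2 e.surjective) h
    ((ExtVanishes.of_subsingleton i).extVanishesAt (Ideal.IsPrime.ne_top ‹_›))

/-- Nakayama's lemma for `Ext` along a regular element. -/
theorem ExtVanishesAt.of_quotSMulTop [IsNoetherianRing R] [Module.Finite R N] [q.IsPrime] {x : R}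
    (hx : x ∈ q) (hreg : IsSMulRegular N x) {i : ℕ}
    (h : ExtVanishesAt R q (QuotSMulTop x N) (i + 1)) : ExtVanishesAt R q N i := by
  have S := moduleCat_shortExact (f := LinearMap.lsmul R N x) (g := (x • (⊤ : Submodule R N)).mkQ)
    hreg (Submodule.mkQ_surjective _) (LinearMap.exact_lsmul_mkQ_smul_top N x)
  obtain ⟨s, hs, h⟩ := h
  set E := Abelian.Ext.{u} (ModuleCat.of R N) (ModuleCat.of R R) i
  have hrange : LinearMap.range (LinearMap.lsmul R E s) ≤ Ideal.span {x} • ⊤ := by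
    rintro _ ⟨e, rfl⟩
    obtain ⟨y, hy⟩ := Abelian.Ext.contravariant_sequence_exact₁ S (ModuleCat.of R R) (s • e)
      (add_comm 1 i) ((Abelian.Ext.comp_smul ..).trans (h _))
    have : x • y = s • e := (Ext.smul_eq_mk₀_lsmul_comp x y).symm.trans hy
    rw [LinearMap.lsmul_apply, ← this]
    exact Submodule.smul_mem_smul (Ideal.mem_span_singleton_self x) trivial
  -- Determinant trick: `s` maps `E` into `xE`, so a monic `p` with lower coefficients in `(x)`
  -- satisfies `p(s) E = 0`. Modulo `q`, `p(s)` is a power of `s`, so it lies outside `q`.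
  obtain ⟨p, hp, -, hc, h0⟩ :=
    LinearMap.exists_monic_and_natDegree_eq_and_coeff_mem_pow_and_aeval_eq_zero _ _ _ hrange
  have hIq : Ideal.span {x} ≤ q := (Ideal.span_singleton_le_iff_mem q).mpr hx
  refine ⟨p.eval s, fun hmem ↦ hs ?_, fun e ↦ ?_⟩
  · rw [Polynomial.eval_eq_sum_range, Finset.sum_range_succ, hp.coeff_natDegree, one_mul,
      Ideal.add_mem_iff_right] at hmem
    · exact ‹q.IsPrime›.mem_of_pow_mem _ hmem
    · refine Ideal.sum_mem _ fun k hk ↦ Ideal.mul_mem_right _ _ (hIq ?_)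
      exact Ideal.pow_le_self (by have := Finset.mem_range.mp hk; omega) (hc k)
  · have h1 : (LinearMap.lsmul R E s) = algebraMap R (Module.End R E) s := rfl
    rw [h1, Polynomial.aeval_algebraMap_apply] at h0
    have := LinearMap.congr_fun h0 e
    simpa using this

/-- Reduction of local vanishing of `Ext` to the cyclic modules `R ⧸ p`. -/
theorem ExtVanishesAt.of_support [IsNoetherianRing R] [q.IsPrime] {i : ℕ}
    (N : Type u) [AddCommGroup N] [Module R N] [hN : Module.Finite R N]
    (h : ∀ p ∈ Module.support R N, ExtVanishesAt R q (R ⧸ p.asIdeal) i) :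
    ExtVanishesAt R q N i := by
  revert h
  induction hN using IsNoetherianRing.induction_on_isQuotientEquivQuotientPrime R with
  | subsingleton N =>
    exact fun _ ↦ (ExtVanishes.of_subsingleton i).extVanishesAt (Ideal.IsPrime.ne_top ‹_›)
  | quotient N p e =>
    refine fun h ↦ (h p ?_).of_linearEquiv e.symm
    rw [e.support_eq, Module.mem_support_iff_of_finite, Ideal.annihilator_quotient]
  | exact N₁ N₂ N₃ f g hf hg hfg h₁ h₃ =>
    intro h
    rw [Module.support_of_exact hfg hf hg] at h
    exact .middle hf hg hfg (h₁ fun p hp ↦ h p (.inl hp)) (h₃ fun p hp ↦ h p (.inr hp))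

theorem isSMulRegular_quotient_of_notMem {p : Ideal R} [p.IsPrime] {x : R} (hx : x ∉ p) :
    IsSMulRegular (R ⧸ p) x := by
  rw [isSMulRegular_iff_right_eq_zero_of_smul]
  intro y hy
  obtain ⟨y, rfl⟩ := Ideal.Quotient.mk_surjective y
  rw [← Ideal.Quotient.mk_eq_mk, ← Submodule.Quotient.mk_smul, Submodule.Quotient.mk_eq_zero] at hy
  exact Ideal.Quotient.eq_zero_iff_mem.mpr ((‹p.IsPrime›.mem_or_mem hy).resolve_left hx)

/-- Nonvanishing of local `Ext` propagates along inclusions of primes. -/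
theorem exists_not_extVanishesAt_of_lt [IsNoetherianRing R] [hq : q.IsPrime] (p : Ideal R)
    (hp : p.IsPrime) (hpq : p < q) (i : ℕ) (h : ¬ ExtVanishesAt R q (R ⧸ p) i) :
    ∃ j > i, ¬ ExtVanishesAt R q (R ⧸ q) j := by
  induction p using WellFoundedGT.induction generalizing i with
  | ind p ih =>
    obtain ⟨x, hxq, hxp⟩ := SetLike.exists_of_lt hpq
    -- Killing an element of `q` outside `p` raises the nonvanishing degree by one. Dévissage then
    -- finds a prime strictly above `p` carrying it; this prime lies in `q`, as otherwise an element
    -- outside `q` would annihilate the Ext.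
    have h1 : ¬ ExtVanishesAt R q (QuotSMulTop x (R ⧸ p)) (i + 1) := fun h' ↦
      h (h'.of_quotSMulTop hxq (isSMulRegular_quotient_of_notMem hxp))
    obtain ⟨p', hp', h2⟩ : ∃ p' ∈ Module.support R (QuotSMulTop x (R ⧸ p)),
        ¬ ExtVanishesAt R q (R ⧸ p'.asIdeal) (i + 1) := by
      by_contra! hcon
      exact h1 (.of_support _ hcon)
    have hle : Module.annihilator R (QuotSMulTop x (R ⧸ p)) ≤ p'.asIdeal :=
      Module.mem_support_iff_of_finite.mp hp'
    have hxp' : x ∈ p'.asIdeal := hle (QuotSMulTop.mem_annihilator _ x)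
    have hpp' : p ≤ p'.asIdeal := by
      refine le_trans ?_ hle
      have := LinearMap.annihilator_le_of_surjective (R := R) (x • (⊤ : Submodule R (R ⧸ p))).mkQ
        (Submodule.mkQ_surjective _)
      rwa [Ideal.annihilator_quotient] at this
    have hlt : p < p'.asIdeal := lt_of_le_of_ne hpp' fun he ↦ hxp (he ▸ hxp')
    have hp'q : p'.asIdeal ≤ q := by
      intro s hs
      by_contra hsq
      refine h2 (.of_smul_eq_zero hsq (fun y ↦ ?_) _)
      obtain ⟨y, rfl⟩ := Ideal.Quotient.mk_surjective y
      rw [← Ideal.Quotient.mk_eq_mk, ← Submodule.Quotient.mk_smul, Submodule.Quotient.mk_eq_zero]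
      exact Ideal.mul_mem_right _ _ hs
    obtain he | hlt' := eq_or_lt_of_le hp'q
    · exact ⟨i + 1, by omega, he ▸ h2⟩
    · obtain ⟨j, hj, h3⟩ := ih p'.asIdeal hlt p'.2 hlt' (i + 1) h2
      exact ⟨j, by omega, h3⟩

theorem ExtVanishesAt.mono {p : Ideal R} (hpq : p ≤ q) {i : ℕ} (h : ExtVanishesAt R q N i) :
    ExtVanishesAt R p N i :=
  let ⟨s, hs, h⟩ := h
  ⟨s, fun h' ↦ hs (hpq h'), h⟩

/-- A minimal prime `p` is associated, so `Hom(R/p, R)` is nonzero locally at `p`. Each strict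
inclusion in the chain then raises the nonvanishing degree by at least one. -/
theorem exists_not_extVanishesAt_of_ltSeries [IsNoetherianRing R] (l : LTSeries (PrimeSpectrum R)) :
    ∃ j ≥ l.length, ¬ ExtVanishesAt R l.last.asIdeal (R ⧸ l.last.asIdeal) j := by
  induction l using RelSeries.inductionOn' with
  | singleton q =>
    change ∃ j ≥ 0, ¬ ExtVanishesAt R q.asIdeal (R ⧸ q.asIdeal) j
    obtain ⟨p, hp, hpq⟩ := Ideal.exists_minimalPrimes_le (I := Module.annihilator R R)
      (J := q.asIdeal) (by simp [Module.annihilator_eq_bot.mpr inferInstance])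
    have hass := Module.associatedPrimes.minimalPrimes_annihilator_subset_associatedPrimes R R hp
    obtain ⟨hprime, f, hf⟩ := (isAssociatedPrime_iff_exists_injective_linearMap _ _).mp hass
    have h0 : ¬ ExtVanishesAt R p (R ⧸ p) 0 := by
      rintro ⟨s, hs, h⟩
      have h1 := h (Abelian.Ext.mk₀ (ModuleCat.ofHom f))
      rw [← Abelian.Ext.mk₀_smul, Abelian.Ext.mk₀_eq_zero_iff] at h1
      have h2 : s • f (Ideal.Quotient.mk p 1) = 0 :=
        LinearMap.congr_fun (congrArg ModuleCat.Hom.hom h1) (Ideal.Quotient.mk p 1)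
      rw [← map_smul, map_eq_zero_iff f hf, ← Ideal.Quotient.mk_eq_mk,
        ← Submodule.Quotient.mk_smul, Submodule.Quotient.mk_eq_zero] at h2
      exact hs (by simpa using h2)
    obtain rfl | hlt := eq_or_lt_of_le hpq
    · exact ⟨0, le_rfl, h0⟩
    · obtain ⟨j, -, h⟩ := exists_not_extVanishesAt_of_lt p hprime hlt 0 fun h ↦ h0 (h.mono hpq)
      exact ⟨j, Nat.zero_le _, h⟩
  | snoc l q hq ih =>
    obtain ⟨j, hj, h⟩ := ih
    have hlt : l.last.asIdeal < q.asIdeal := hq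
    obtain ⟨k, hk, h'⟩ := exists_not_extVanishesAt_of_lt l.last.asIdeal l.last.2 hlt j
      fun h' ↦ h (h'.mono hlt.le)
    rw [RelSeries.last_snoc, RelSeries.snoc_length]
    exact ⟨k, by omega, h'⟩

/-- The Krull dimension is bounded by the self-injective dimension. -/
theorem ringKrullDim_le_of_finiteSelfInjectiveDimension [IsNoetherianRing R] {n : ℕ}
    (hR : FiniteSelfInjectiveDimension R n) : ringKrullDim R ≤ n := by
  refine iSup_le fun l ↦ ?_
  obtain ⟨j, hj, h⟩ := exists_not_extVanishesAt_of_ltSeries l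
  have : j ≤ n := by
    by_contra! hn
    exact h (((hR _).ext j hn).extVanishesAt l.last.2.ne_top)
  exact_mod_cast hj.trans this

end LocalExt

/-! ### Finite self-injective dimension implies Cohen–Macaulay. -/

section RegularSequence

open RingTheory.Sequence
open scoped Pointwise

variable {R : Type u} [CommRing R]

/-- Each regular element costs one degree: `Ext^{i+1}(M/xM, R)` sits between `Ext^i(M, R)` and
`Ext^{i+1}(M, R)`. -/
theorem ExtVanishesAbove.quotient_ofList {M : Type u} [AddCommGroup M] [Module R M] {k : ℕ}
    (h : ExtVanishesAbove R k M) {rs : List R} (hrs : IsWeaklyRegular M rs) :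
    ExtVanishesAbove R (k + rs.length) (M ⧸ (Ideal.ofList rs • ⊤ : Submodule R M)) := by
  induction rs generalizing M k with
  | nil =>
    have := h.finite
    exact ⟨inferInstance, fun i hi ↦ (h.ext i hi).of_linearEquiv
      (Submodule.quotEquivOfEqBot _ (by simp)).symm⟩
  | cons x rs ih =>
    have := h.finite
    rw [isWeaklyRegular_cons_iff] at hrs
    have h1 : ExtVanishesAbove R (k + 1) (QuotSMulTop x M) := by
      refine ⟨inferInstance, fun i hi ↦ ?_⟩
      obtain ⟨i, rfl⟩ : ∃ j, i = j + 1 := ⟨i - 1, by omega⟩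
      exact ExtVanishes.right (f := LinearMap.lsmul R M x) (g := (x • (⊤ : Submodule R M)).mkQ)
        hrs.1 (Submodule.mkQ_surjective _) (LinearMap.exact_lsmul_mkQ_smul_top M x)
        (h.ext i (by omega)) (h.ext (i + 1) (by omega))
    refine ⟨inferInstance, fun i hi ↦ ((ih h1 hrs.2).ext i ?_).of_linearEquiv
      (Submodule.quotOfListConsSMulTopEquivQuotSMulTopInner M x rs).symm⟩
    simp only [List.length_cons] at hi
    omega

variable [IsLocalRing R] [IsNoetherianRing R]

/-- Over a local ring, the self-injective dimension is detected by the residue field. -/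
theorem FiniteSelfInjectiveDimension.of_residueField {n : ℕ}
    (hR : FiniteSelfInjectiveDimension R (n + 1))
    (h : ExtVanishes R (R ⧸ IsLocalRing.maximalIdeal R) (n + 1)) :
    FiniteSelfInjectiveDimension R n := by
  intro X _ _ _
  refine ⟨inferInstance, fun i hi ↦ ?_⟩
  obtain rfl | hlt : i = n + 1 ∨ n + 1 < i := by omega
  · refine ExtVanishesAt.extVanishes (.of_support X fun p _ ↦ ?_)
    by_cases hp : IsLocalRing.maximalIdeal R ≤ p.asIdeal
    · have : p.asIdeal = IsLocalRing.maximalIdeal R :=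
        le_antisymm (IsLocalRing.le_maximalIdeal p.2.ne_top) hp
      rw [this]
      exact h.extVanishesAt (Ideal.IsPrime.ne_top inferInstance)
    -- For a nonmaximal prime no hypothesis on the residue field is needed: Ext of `R/(p + xR)`
    -- already vanishes in degree `n + 2`, and Nakayama lowers this to `R/p` in degree `n + 1`.
    · obtain ⟨x, hx, hxp⟩ := SetLike.not_le_iff_exists.mp hp
      exact .of_quotSMulTop hx (isSMulRegular_quotient_of_notMem hxp)
        (((hR _).ext _ (by omega)).extVanishesAt (Ideal.IsPrime.ne_top inferInstance))
  · exact (hR X).ext i hlt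

theorem length_le_of_isRegular {d : ℕ} (hd : ringKrullDim R = d) {M : Type u} [AddCommGroup M]
    [Module R M] [Module.Finite R M] {rs : List R} (h : IsRegular M rs) : rs.length ≤ d := by
  have h1 := Module.supportDim_add_length_eq_supportDim_of_isRegular (R := R) (M := M) rs h
  have h2 := Module.supportDim_le_ringKrullDim R M
  have : Nontrivial (M ⧸ (Ideal.ofList rs • ⊤ : Submodule R M)) :=
    h.quot_ofList_smul_nontrivial ⊤
  rw [hd, ← h1] at h2
  have h3 : (0 : WithBot ℕ∞) ≤ Module.supportDim R (M ⧸ (Ideal.ofList rs • ⊤ : Submodule R M)) := by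
    have := (Module.supportDim_ne_bot_iff_nontrivial R
      (M ⧸ (Ideal.ofList rs • ⊤ : Submodule R M))).mpr this
    obtain ⟨a, ha⟩ := WithBot.ne_bot_iff_exists.mp this
    rw [← ha]
    exact WithBot.coe_le_coe.mpr (zero_le)
  have h4 : ((rs.length : ℕ) : WithBot ℕ∞) ≤ (d : WithBot ℕ∞) :=
    le_trans (by simpa using add_le_add_left h3 (rs.length : WithBot ℕ∞)) h2
  exact_mod_cast h4

/-- A regular sequence in the maximal ideal that cannot be prolonged. -/
theorem exists_maximal_isRegular {d : ℕ} (hd : ringKrullDim R = d) :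
    ∃ rs : List R, (∀ x ∈ rs, x ∈ IsLocalRing.maximalIdeal R) ∧ IsRegular R rs ∧
      ∃ f : R ⧸ IsLocalRing.maximalIdeal R →ₗ[R] R ⧸ (Ideal.ofList rs • ⊤ : Submodule R R),
        Function.Injective f := by
  classical
  let P : ℕ → Prop := fun k ↦ ∃ rs : List R, (∀ x ∈ rs, x ∈ IsLocalRing.maximalIdeal R) ∧
    IsRegular R rs ∧ rs.length = k
  have h0 : P 0 := ⟨[], by simp, .nil R R, rfl⟩
  obtain ⟨rs, hmem, hreg, hlen⟩ := Nat.findGreatest_spec (P := P) (Nat.zero_le d) h0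
  refine ⟨rs, hmem, hreg, ?_⟩
  set Q := R ⧸ (Ideal.ofList rs • ⊤ : Submodule R R)
  -- By maximality of the length, the maximal ideal consists of zero divisors on `Q`. Prime
  -- avoidance then makes it an associated prime.
  have hsub : (IsLocalRing.maximalIdeal R : Set R) ⊆ ⋃ p ∈ associatedPrimes R Q, p := by
    rw [biUnion_associatedPrimes_eq_zero_divisors]
    intro x hx
    by_contra hcon
    have hxreg : IsSMulRegular Q x := by
      rw [isSMulRegular_iff_right_eq_zero_of_smul]
      intro y hy
      by_contra hy0
      exact hcon ⟨y, hy0, hy⟩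
    have hmem' : ∀ y ∈ rs ++ [x], y ∈ IsLocalRing.maximalIdeal R := by
      intro y hy
      rcases List.mem_append.mp hy with hy | hy
      · exact hmem y hy
      · rwa [List.mem_singleton.mp hy]
    have hreg' : IsRegular R (rs ++ [x]) := by
      rw [IsLocalRing.isRegular_iff_isWeaklyRegular_of_subset_maximalIdeal hmem',
        isWeaklyRegular_append_iff]
      exact ⟨hreg.1, (isWeaklyRegular_singleton_iff Q x).mpr hxreg⟩
    have hle := length_le_of_isRegular hd hreg'
    have := Nat.le_findGreatest (P := P) hle ⟨_, hmem', hreg', rfl⟩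
    simp only [List.length_append, List.length_singleton] at this
    omega
  obtain ⟨p, hp, hle⟩ := (Ideal.subset_union_prime_finite (associatedPrimes.finite R Q) (f := id)
    0 0 fun _ h _ _ ↦ IsAssociatedPrime.isPrime h).mp hsub
  have : p = IsLocalRing.maximalIdeal R :=
    le_antisymm (IsLocalRing.le_maximalIdeal (IsAssociatedPrime.isPrime hp).ne_top) hle
  subst this
  exact ((isAssociatedPrime_iff_exists_injective_linearMap _ _).mp hp).2

/-- A local ring of finite self-injective dimension is Cohen-Macaulay, and its self-injective
dimension is its Krull dimension. -/
theorem FiniteSelfInjectiveDimension.exists_isRegular {n d : ℕ}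
    (hR : FiniteSelfInjectiveDimension R n) (hd : ringKrullDim R = d) :
    FiniteSelfInjectiveDimension R d ∧ ∃ rs : List R,
      (∀ x ∈ rs, x ∈ IsLocalRing.maximalIdeal R) ∧ IsRegular R rs ∧ rs.length = d := by
  obtain ⟨rs, hmem, hreg, f, hf⟩ := exists_maximal_isRegular hd
  have hQ : ExtVanishesAbove R rs.length (R ⧸ (Ideal.ofList rs • ⊤ : Submodule R R)) := by
    have h0 : ExtVanishesAbove R 0 R := ⟨inferInstance, fun i hi ↦ by
      obtain ⟨i, rfl⟩ : ∃ j, i = j + 1 := ⟨i - 1, by omega⟩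
      exact .of_projective i⟩
    simpa using h0.quotient_ofList hreg.1
  have hle := length_le_of_isRegular hd hreg
  have hdim : FiniteSelfInjectiveDimension R rs.length := by
    -- A bound above `rs.length` can be lowered by one: the residue field embeds in `R/(rs)`, so its
    -- Ext in that degree lies between that of `R/(rs)` and the next Ext of the cokernel, both zero.
    have key : ∀ k, FiniteSelfInjectiveDimension R (rs.length + k) →
        FiniteSelfInjectiveDimension R rs.length := by
      intro k
      induction k with
      | zero => exact id
      | succ k ih =>
        intro h
        refine ih (h.of_residueField ?_)
        exact ExtVanishes.left hf (Submodule.mkQ_surjective _) (LinearMap.exact_map_mkQ_range f)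
          (hQ.ext (rs.length + k + 1) (by omega)) ((h _).ext _ (by simp; omega))
    exact key n fun X _ _ _ ↦ (hR X).mono (by omega)
  have hge := ringKrullDim_le_of_finiteSelfInjectiveDimension hdim
  rw [hd] at hge
  have hge : d ≤ rs.length := by exact_mod_cast hge
  have : rs.length = d := le_antisymm hle hge
  exact ⟨this ▸ hdim, rs, hmem, hreg, this⟩

end RegularSequence

/-! ### Perpendicular modules are maximal Cohen–Macaulay. -/

section MaximalCohenMacaulay

open RingTheory.Sequence
open scoped Pointwise

variable {R : Type u} [CommRing R]

/-- This is the vanishing of `Tor_1(R/x, W)` for `x` regular on `W`. -/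
theorem QuotSMulTop.map_injective_of_isSMulRegular {X G W : Type u} [AddCommGroup X] [Module R X]
    [AddCommGroup G] [Module R G] [AddCommGroup W] [Module R W] {f : X →ₗ[R] G} {g : G →ₗ[R] W}
    (hf : Function.Injective f) (hfg : Function.Exact f g) {x : R} (hx : IsSMulRegular W x) :
    Function.Injective (QuotSMulTop.map x f) := by
  rw [injective_iff_map_eq_zero]
  intro y hy
  obtain ⟨y, rfl⟩ := Submodule.Quotient.mk_surjective _ y
  rw [QuotSMulTop.map_apply_mk, Submodule.Quotient.mk_eq_zero,
    Submodule.mem_smul_pointwise_iff_exists] at hy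
  obtain ⟨z, -, hz⟩ := hy
  have hgz : g z = 0 := by
    refine hx.right_eq_zero_of_smul ?_
    rw [← map_smul, hz, hfg.apply_apply_eq_zero]
  obtain ⟨w, rfl⟩ := (hfg z).mp hgz
  rw [Submodule.Quotient.mk_eq_zero, Submodule.mem_smul_pointwise_iff_exists]
  exact ⟨w, trivial, hf (by rw [map_smul, hz])⟩

/-- A sequence is weakly regular on all modules of a class whose members embed, with cokernel in
the class, in modules on which the sequence is weakly regular. -/
theorem isWeaklyRegular_of_coresolved (rs : List R)
    (S : ∀ (X : Type u) [AddCommGroup X] [Module R X], Prop)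
    (hS : ∀ (X : Type u) [AddCommGroup X] [Module R X], S X →
      ∃ (G W : Type u) (_ : AddCommGroup G) (_ : Module R G) (_ : AddCommGroup W) (_ : Module R W)
        (f : X →ₗ[R] G) (g : G →ₗ[R] W), Function.Injective f ∧ Function.Surjective g ∧
          Function.Exact f g ∧ IsWeaklyRegular G rs ∧ S W)
    (X : Type u) [AddCommGroup X] [Module R X] (hX : S X) : IsWeaklyRegular X rs := by
  induction rs generalizing S X with
  | nil => exact .nil R X
  | cons x rs ih =>
    have hreg : ∀ (X : Type u) [AddCommGroup X] [Module R X], S X → IsSMulRegular X x := by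
      intro X _ _ hX
      obtain ⟨G, W, _, _, _, _, f, g, hf, -, -, hG, -⟩ := hS X hX
      exact ((isWeaklyRegular_cons_iff G x rs).mp hG).1.of_injective f hf
    rw [isWeaklyRegular_cons_iff]
    -- The induction passes to the class of quotients `X/xX`. Its coresolutions are the old ones
    -- modulo `x`, still exact because `x` is regular on each cokernel.
    refine ⟨hreg X hX, ih (fun Y _ _ ↦ ∃ (X : Type u) (_ : AddCommGroup X) (_ : Module R X),
      S X ∧ Nonempty (Y ≃ₗ[R] QuotSMulTop x X)) ?_ _ ⟨X, _, _, hX, ⟨.refl _ _⟩⟩⟩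
    rintro Y _ _ ⟨X, _, _, hX, ⟨e⟩⟩
    obtain ⟨G, W, _, _, _, _, f, g, hf, hg, hfg, hG, hW⟩ := hS X hX
    refine ⟨QuotSMulTop x G, QuotSMulTop x W, inferInstance, inferInstance, inferInstance,
      inferInstance, QuotSMulTop.map x f ∘ₗ e.toLinearMap, QuotSMulTop.map x g, ?_,
      QuotSMulTop.map_surjective x hg, ?_, ((isWeaklyRegular_cons_iff G x rs).mp hG).2,
      W, _, _, hW, ⟨.refl _ _⟩⟩
    · exact (QuotSMulTop.map_injective_of_isSMulRegular hf hfg (hreg W hW)).comp e.injective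
    · intro y
      rw [QuotSMulTop.map_exact x hfg hg y]
      simp [e.surjective.exists, Set.mem_range]

theorem IsGorensteinLocalRing.exists_finiteSelfInjectiveDimension [IsLocalRing R]
    (hR : IsGorensteinLocalRing R) : ∃ n, FiniteSelfInjectiveDimension R n := by
  obtain ⟨hN, n, hn⟩ := hR
  exact ⟨n, fun X _ _ hX ↦ ⟨hX, fun i hi ↦
    HasInjectiveDimensionLT.subsingleton (ModuleCat.of R R) (n + 1) i hi (ModuleCat.of R X)⟩⟩

/-- Over a local ring of finite self-injective dimension, a module `X` with `Ext^i(X, R) = 0` for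
all `i > 0` is maximal Cohen-Macaulay. -/
theorem ExtVanishesAbove.isMaximalCohenMacaulay [IsLocalRing R] [IsNoetherianRing R] {n d : ℕ}
    (hR : FiniteSelfInjectiveDimension R n) (hd : ringKrullDim R = d) {X : Type u}
    [AddCommGroup X] [Module R X] (hX : ExtVanishesAbove R 0 X) : IsMaximalCohenMacaulay R X := by
  have := hX.finite
  refine ⟨this, or_iff_not_imp_left.mpr fun hns ↦ ?_⟩
  have : Nontrivial X := not_subsingleton_iff_nontrivial.mp hns
  obtain ⟨-, rs, hmem, hreg, hlen⟩ := hR.exists_isRegular hd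
  have hweak : IsWeaklyRegular X rs := by
    refine isWeaklyRegular_of_coresolved rs (fun X _ _ ↦ ExtVanishesAbove R 0 X) ?_ X hX
    intro X _ _ hX
    obtain ⟨m, a, ha⟩ := hX.exists_cosyzygy hR
    obtain ⟨h1, -, h2⟩ := ha 0 0
    refine ⟨_, _, _, _, _, _, _, _, h1, Submodule.mkQ_surjective _, LinearMap.exact_map_mkQ_range _,
      ?_, h2⟩
    have := hreg.1.isWeaklyRegular_lTensor (M₂ := (Fin 0 → R) × (Fin m → R))
    rwa [(TensorProduct.rid R _).isWeaklyRegular_congr] at this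
  have hXreg : IsRegular X rs :=
    (IsLocalRing.isRegular_iff_isWeaklyRegular_of_subset_maximalIdeal hmem).mpr hweak
  have : moduleDepth R X = d := by
    refine le_antisymm ?_ ?_
    · exact iSup_le fun rs' ↦ iSup_le fun _ ↦ iSup_le fun h ↦
        by exact_mod_cast length_le_of_isRegular hd h
    · rw [← hlen]
      exact le_iSup_of_le rs (le_iSup_of_le hmem (le_iSup_of_le hXreg le_rfl))
  rw [this, hd]
  rfl

end MaximalCohenMacaulay

/-! ### Dimension shifting for Tor by spliced resolutions. -/

section TorVanishing

namespace CategoryTheory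

variable {C D : Type*} [Category* C] [Abelian C] [Category* D] [Abelian D]

theorem augment_exact {K : ChainComplex C ℕ} {S : ShortComplex C} (hS : S.ShortExact)
    (p : K.X 0 ⟶ S.X₁) [Epi p] (w : K.d 1 0 ≫ p = 0) (hp : (ShortComplex.mk _ _ w).Exact)
    (hK : ∀ n, K.ExactAt (n + 1)) (n : ℕ) :
    (K.augment (p ≫ S.f) (by rw [reassoc_of% w, zero_comp])).ExactAt (n + 1) := by
  rw [HomologicalComplex.exactAt_iff' _ (n + 2) (n + 1) n (by simp) (by simp)]
  have := hS.mono_f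
  obtain _ | n := n
  · exact (ShortComplex.exact_iff_of_epi_of_isIso_of_mono
      (S₁ := ShortComplex.mk _ _ w)
      (S₂ := ShortComplex.mk (K.d 1 0) (p ≫ S.f) (by rw [reassoc_of% w, zero_comp]))
      { τ₁ := 𝟙 _, τ₂ := 𝟙 _, τ₃ := S.f }).mp hp
  · exact (HomologicalComplex.exactAt_iff' _ (n + 2) (n + 1) n (by simp) (by simp)).mp (hK n)

/-- The augmentation of a projective resolution. -/
def ProjectiveResolution.augmentation {X : C} (P : ProjectiveResolution X) : P.complex.X 0 ⟶ X :=
  P.π.f 0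

instance {X : C} (P : ProjectiveResolution X) : Epi P.augmentation :=
  inferInstanceAs (Epi (P.π.f 0))

theorem ProjectiveResolution.d_comp_augmentation {X : C} (P : ProjectiveResolution X) :
    P.complex.d 1 0 ≫ P.augmentation = 0 :=
  P.complex_d_comp_π_f_zero

theorem ProjectiveResolution.exact_augmentation {X : C} (P : ProjectiveResolution X) :
    (ShortComplex.mk _ _ P.d_comp_augmentation).Exact :=
  P.exact₀

/-- Splicing a projective resolution of the first term of a short exact sequence with projective
middle term yields a projective resolution of the last term. -/
noncomputable def ProjectiveResolution.splice {S : ShortComplex C} (hS : S.ShortExact)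
    [Projective S.X₂] (P : ProjectiveResolution S.X₁) : ProjectiveResolution S.X₃ where
  complex := P.complex.augment (P.augmentation ≫ S.f) (by
    rw [← Category.assoc, P.d_comp_augmentation, zero_comp])
  projective n := by
    obtain _ | n := n
    · exact (inferInstance : Projective S.X₂)
    · exact P.projective n
  π := (ChainComplex.toSingle₀Equiv _ _).symm ⟨S.g, by
    change (P.augmentation ≫ S.f) ≫ S.g = 0
    rw [Category.assoc, S.zero, comp_zero]⟩
  quasiIso := ⟨fun n ↦ by
    have := hS.epi_g
    obtain _ | n := n
    · rw [ChainComplex.quasiIsoAt₀_iff, ShortComplex.quasiIso_iff_of_zeros']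
      · refine ⟨?_, ?_⟩
        · let φ : ShortComplex.mk (P.augmentation ≫ S.f) S.g
              (by rw [Category.assoc, S.zero, comp_zero]) ⟶ S :=
            { τ₁ := P.augmentation, τ₂ := 𝟙 _, τ₃ := 𝟙 _ }
          have : Epi φ.τ₁ := inferInstanceAs (Epi P.augmentation)
          have : IsIso φ.τ₂ := inferInstanceAs (IsIso (𝟙 _))
          have : Mono φ.τ₃ := inferInstanceAs (Mono (𝟙 _))
          convert (ShortComplex.exact_iff_of_epi_of_isIso_of_mono φ).mpr hS.exact using 1
          congr 1
          exact ChainComplex.toSingle₀Equiv_symm_apply_f_zero ..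
        · exact (congrArg Epi (ChainComplex.toSingle₀Equiv_symm_apply_f_zero
            (C := P.complex.augment (P.augmentation ≫ S.f) _) (X := S.X₃) S.g _)).mpr this
      all_goals rfl
    · refine (quasiIsoAt_iff_exactAt' _ _ (ChainComplex.exactAt_succ_single_obj _ _)).mpr ?_
      exact augment_exact hS P.augmentation P.d_comp_augmentation P.exact_augmentation
        P.complex_exactAt_succ n⟩

theorem isZero_leftDerived_obj_iff [HasProjectiveResolutions C] (F : C ⥤ D) [F.Additive] {X : C}
    (P : ProjectiveResolution X) (n : ℕ) : IsZero ((F.leftDerived n).obj X) ↔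
      (((F.mapHomologicalComplex _).obj P.complex)).ExactAt n := by
  rw [HomologicalComplex.exactAt_iff_isZero_homology]
  exact (P.isoLeftDerivedObj F n).isZero_iff

/-- The spliced resolution is a resolution of `S.X₁` shifted by one, so the two complexes agree
around these degrees. -/
theorem isZero_leftDerived_succ_iff_of_shortExact [HasProjectiveResolutions C] (F : C ⥤ D)
    [F.Additive] {S : ShortComplex C} (hS : S.ShortExact) [Projective S.X₂] (n : ℕ) :
    IsZero ((F.leftDerived (n + 2)).obj S.X₃) ↔ IsZero ((F.leftDerived (n + 1)).obj S.X₁) := by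
  let P := projectiveResolution S.X₁
  rw [isZero_leftDerived_obj_iff F P, isZero_leftDerived_obj_iff F (P.splice hS),
    HomologicalComplex.exactAt_iff' _ (n + 3) (n + 2) (n + 1) (by simp) (by simp),
    HomologicalComplex.exactAt_iff' _ (n + 2) (n + 1) n (by simp) (by simp)]
  rfl

end CategoryTheory

variable {R : Type u} [CommRing R] {M Z F C : Type u} [AddCommGroup M] [Module R M]
  [AddCommGroup Z] [Module R Z] [AddCommGroup F] [Module R F] [AddCommGroup C] [Module R C]

theorem torVanishes_succ_succ_iff [Module.Projective R F] {f : Z →ₗ[R] F} {g : F →ₗ[R] C}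
    (hf : Function.Injective f) (hg : Function.Surjective g) (hfg : Function.Exact f g) (n : ℕ) :
    TorVanishes R M C (n + 2) ↔ TorVanishes R M Z (n + 1) := by
  have S := moduleCat_shortExact hf hg hfg
  have : Projective (ModuleCat.of R F) := (IsProjective.iff_projective _).mp inferInstance
  exact isZero_leftDerived_succ_iff_of_shortExact _ S n

/-- In degree 1 the spliced complex reads `M ⊗ P₁ → M ⊗ P₀ → M ⊗ F`, and the cokernel of its first
map is `M ⊗ Z`. -/
theorem torVanishes_one_iff [Module.Projective R F] {f : Z →ₗ[R] F} {g : F →ₗ[R] C}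
    (hf : Function.Injective f) (hg : Function.Surjective g) (hfg : Function.Exact f g) :
    TorVanishes R M C 1 ↔ Function.Injective (f.lTensor M) := by
  have S := moduleCat_shortExact hf hg hfg
  have : Projective (ModuleCat.of R F) := (IsProjective.iff_projective _).mp inferInstance
  let P := projectiveResolution (ModuleCat.of R Z)
  have hp : Function.Surjective (P.augmentation).hom :=
    (ModuleCat.epi_iff_surjective _).mp inferInstance
  have hexact : Function.Exact (P.complex.d 1 0).hom (P.augmentation).hom :=
    (ShortComplex.ShortExact.moduleCat_exact_iff_function_exact _).mp P.exact_augmentation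
  have hp' := LinearMap.lTensor_surjective M hp
  have hexact' := lTensor_exact M hexact hp
  have h1 : TorVanishes R M C 1 ↔ Function.Exact ((P.complex.d 1 0).hom.lTensor M)
      ((f ∘ₗ (P.augmentation).hom).lTensor M) := by
    refine (isZero_leftDerived_obj_iff _ (P.splice S) 1).trans ?_
    rw [HomologicalComplex.exactAt_iff' _ 2 1 0 (by simp) (by simp),
      ShortComplex.ShortExact.moduleCat_exact_iff_function_exact]
    rfl
  rw [h1, LinearMap.lTensor_comp, injective_iff_map_eq_zero]
  refine ⟨fun h x hx ↦ ?_, fun h y ↦ ?_⟩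
  · obtain ⟨y, rfl⟩ := hp' x
    obtain ⟨w, rfl⟩ := (h y).mp hx
    exact hexact'.apply_apply_eq_zero w
  · rw [← hexact' y]
    exact ⟨fun hy ↦ h _ hy, fun hy ↦ by rw [LinearMap.comp_apply, hy, map_zero]⟩

theorem torVanishes_succ_of_projective [Module.Projective R C] (n : ℕ) :
    TorVanishes R M C (n + 1) := by
  have : Projective (ModuleCat.of R C) := (IsProjective.iff_projective _).mp inferInstance
  exact Functor.isZero_leftDerived_obj_projective_succ _ n (ModuleCat.of R C)

theorem torVanishes_zero_iff : TorVanishes R M C 0 ↔ Subsingleton (M ⊗[R] C) := by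
  refine Iff.trans (Iso.isZero_iff ((Functor.leftDerivedZeroIsoSelf _).app _)) ?_
  exact ModuleCat.isZero_of_iff_subsingleton

theorem torVanishes_of_subsingleton_right [Subsingleton C] (n : ℕ) : TorVanishes R M C n := by
  obtain _ | n := n
  · exact torVanishes_zero_iff.mpr inferInstance
  · exact torVanishes_succ_of_projective n

theorem torVanishes_of_subsingleton_left [Subsingleton M] (n : ℕ) : TorVanishes R M C n := by
  refine (isZero_leftDerived_obj_iff _ (projectiveResolution (ModuleCat.of R C)) n).mpr ?_
  exact ShortComplex.exact_of_isZero_X₂ _ (ModuleCat.isZero_of_iff_subsingleton.mpr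
    (inferInstanceAs (Subsingleton (M ⊗[R] _))))

/-- By Nakayama, `M ⊗ C = 0` forces `M = 0` or `C = 0`. This settles degree 0, which dimension
shifting does not reach. -/
theorem torVanishes_of_torVanishes_zero [IsLocalRing R] [Module.Finite R M] [Module.Finite R C]
    (h : TorVanishes R M C 0) (n : ℕ) : TorVanishes R M C n := by
  rw [torVanishes_zero_iff] at h
  by_contra hcon
  have hM : Nontrivial M := by
    by_contra hM
    have := not_nontrivial_iff_subsingleton.mp hM
    exact hcon (torVanishes_of_subsingleton_left n)
  have hC : Nontrivial C := by
    by_contra hC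
    have := not_nontrivial_iff_subsingleton.mp hC
    exact hcon (torVanishes_of_subsingleton_right n)
  let k := IsLocalRing.ResidueField R
  have hkM : Nontrivial (k ⊗[R] M) := not_subsingleton_iff_nontrivial.mp fun h ↦
    not_subsingleton M (IsLocalRing.subsingleton_tensorProduct.mp h)
  have hkC : Nontrivial (k ⊗[R] C) := not_subsingleton_iff_nontrivial.mp fun h ↦
    not_subsingleton C (IsLocalRing.subsingleton_tensorProduct.mp h)
  have h1 : Nontrivial ((k ⊗[R] M) ⊗[k] (k ⊗[R] C)) := inferInstance
  have h2 : Nontrivial (k ⊗[R] (M ⊗[R] C)) :=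
    (TensorProduct.AlgebraTensorModule.distribBaseChange R k M C).toEquiv.nontrivial
  have h3 : Subsingleton (k ⊗[R] (M ⊗[R] C)) := inferInstance
  exact not_subsingleton _ h3

end TorVanishing

/-! ### Rank in terms of free submodules with torsion quotient. -/

section Rank

open scoped nonZeroDivisors

variable {R : Type u} [CommRing R] {C : Type u} [AddCommGroup C] [Module R C]

/-- `C` contains a finite free submodule such that the quotient is killed by a non-zero-divisor. -/
def HasFreeRank (R : Type u) [CommRing R] (C : Type u) [AddCommGroup C] [Module R C] : Prop :=
  ∃ (r : ℕ) (f : (Fin r → R) →ₗ[R] C), Function.Injective f ∧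
    ∃ s ∈ nonZeroDivisors R, ∀ c, s • c ∈ LinearMap.range f

theorem eq_zero_of_smul_eq_zero_of_mem_nonZeroDivisors {ι : Type*} {s : R}
    (hs : s ∈ nonZeroDivisors R) {v : ι → R} (h : s • v = 0) : v = 0 := by
  ext i
  exact (mul_right_mem_nonZeroDivisors_eq_zero_iff hs).mp
    ((mul_comm _ _).trans (congrFun h i))

/-- Multiplication by `s` lands in the image of `f`; undoing `f` there gives `σ`. The pair is
inverse up to a non-zero-divisor, which avoids passing to fractions. -/
theorem HasFreeRank.exists_quasi_inverse (h : HasFreeRank R C) :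
    ∃ (r : ℕ) (f : (Fin r → R) →ₗ[R] C) (σ : C →ₗ[R] (Fin r → R)) (s : R),
      s ∈ nonZeroDivisors R ∧ Function.Injective f ∧ (∀ c, f (σ c) = s • c) ∧
        ∀ v, σ (f v) = s • v := by
  obtain ⟨r, f, hf, s, hs, h⟩ := h
  let σ : C →ₗ[R] (Fin r → R) :=
    (LinearEquiv.ofInjective f hf).symm ∘ₗ (LinearMap.lsmul R C s).codRestrict _ h
  have hσ : ∀ c, f (σ c) = s • c := fun c ↦
    congrArg Subtype.val ((LinearEquiv.ofInjective f hf).apply_symm_apply ⟨s • c, h c⟩)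
  exact ⟨r, f, σ, s, hs, hf, hσ, fun v ↦ hf (by rw [hσ, map_smul])⟩

theorem HasFreeRank.of_isTorsion [Module.Finite R C] (h : Module.IsTorsion R C) :
    HasFreeRank R C := by
  obtain ⟨s, hs, hs'⟩ := Submodule.annihilator_top_inter_nonZeroDivisors h
  refine ⟨0, 0, Function.injective_of_subsingleton _, s, hs', fun c ↦ ?_⟩
  rw [Submodule.mem_annihilator.mp hs c trivial]
  exact zero_mem _

theorem HasFreeRank.moduleHasRank (h : HasFreeRank R C) : ModuleHasRank R C := by
  obtain ⟨r, f, hf, s, hs, h⟩ := h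
  set Q := FractionRing R
  have hinj : Function.Injective (f.baseChange Q) :=
    Module.Flat.lTensor_preserves_injective_linearMap (M := Q) f hf
  have hsurj : Function.Surjective (f.baseChange Q) := by
    intro y
    induction y with
    | zero => exact ⟨0, map_zero _⟩
    | add x y hx hy =>
      obtain ⟨a, rfl⟩ := hx
      obtain ⟨b, rfl⟩ := hy
      exact ⟨a + b, map_add _ _ _⟩
    | tmul q c =>
      obtain ⟨v, hv⟩ := h c
      obtain ⟨t, ht⟩ := IsUnit.exists_left_inv (IsLocalization.map_units Q (⟨s, hs⟩ : R⁰))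
      refine ⟨(q * t) ⊗ₜ v, ?_⟩
      rw [LinearMap.baseChange_tmul, hv, ← TensorProduct.smul_tmul, Algebra.smul_def]
      congr 1
      calc algebraMap R Q s * (q * t) = q * (t * algebraMap R Q s) := by ring
        _ = q := by rw [ht, mul_one]
  exact ⟨r, ⟨(LinearEquiv.ofBijective _ ⟨hinj, hsurj⟩).symm.trans
    (TensorProduct.piScalarRight R Q Q (Fin r))⟩⟩

/-- Clear denominators in a basis of `Q ⊗ C` to get `f`. The quotient by its image is torsion and
finitely generated, so one non-zero-divisor kills it. -/
theorem ModuleHasRank.hasFreeRank [Module.Finite R C] (h : ModuleHasRank R C) :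
    HasFreeRank R C := by
  classical
  obtain ⟨r, ⟨e⟩⟩ := h
  let Q := FractionRing R
  let l : C →ₗ[R] Q ⊗[R] C := TensorProduct.mk R Q C 1
  obtain ⟨b, hb⟩ := IsLocalizedModule.exist_integer_multiples_of_finite R⁰ l
    fun i : Fin r ↦ e.symm (Pi.single i 1)
  choose c hc using hb
  let f : (Fin r → R) →ₗ[R] C := Fintype.linearCombination R c
  have hef : ∀ v i, e (l (f v)) i = algebraMap R Q ((b : R) * v i) := by
    intro v i
    have h1 : ∀ j, e (l (c j)) = (b : R) • (Pi.single j 1 : Fin r → Q) := fun j ↦ by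
      rw [hc j, ← algebraMap_smul Q (b : R) (e.symm _), map_smul, e.apply_symm_apply,
        algebraMap_smul]
    have h2 : e (l (f v)) = ∑ j, v j • (b : R) • (Pi.single j 1 : Fin r → Q) := by
      rw [Fintype.linearCombination_apply, map_sum, map_sum]
      refine Finset.sum_congr rfl fun j _ ↦ ?_
      rw [map_smul, ← algebraMap_smul Q (v j) (l (c j)), map_smul, algebraMap_smul, h1]
    rw [h2, Finset.sum_apply]
    simp [Pi.single_apply, Algebra.smul_def, mul_comm]
  have hinj : Function.Injective f := by
    rw [injective_iff_map_eq_zero]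
    intro v hv
    refine eq_zero_of_smul_eq_zero_of_mem_nonZeroDivisors b.2 ?_
    ext i
    have := hef v i
    rw [hv, map_zero, map_zero, Pi.zero_apply] at this
    exact IsFractionRing.injective R Q (by rw [Pi.zero_apply, map_zero]; exact this.symm)
  have htors : Module.IsTorsion R (C ⧸ LinearMap.range f) := by
    intro x
    obtain ⟨x, rfl⟩ := Submodule.Quotient.mk_surjective _ x
    obtain ⟨t, ht⟩ := IsLocalization.exist_integer_multiples_of_finite R⁰ fun i ↦ e (l x) i
    choose v hv using ht
    have h1 : l (((b : R) * t) • x) = l (f v) := by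
      refine e.injective ?_
      ext i
      rw [hef, map_smul, ← algebraMap_smul Q ((b : R) * t) (l x), map_smul, map_mul, map_mul,
        hv, Pi.smul_apply, smul_eq_mul, Algebra.smul_def, mul_assoc]
    obtain ⟨u, hu⟩ := (IsLocalizedModule.eq_iff_exists R⁰ l).mp h1
    refine ⟨u * (b * t), ?_⟩
    change Submodule.Quotient.mk (((u : R) * ((b : R) * t)) • x) = 0
    rw [Submodule.Quotient.mk_eq_zero, mul_smul]
    refine ⟨(u : R) • v, ?_⟩
    rw [map_smul]
    exact hu.symm
  obtain ⟨s, hs, hs'⟩ := Submodule.annihilator_top_inter_nonZeroDivisors htors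
  refine ⟨r, f, hinj, s, hs', fun c ↦ ?_⟩
  have := Submodule.mem_annihilator.mp hs (Submodule.Quotient.mk c) trivial
  rwa [← Submodule.Quotient.mk_smul, Submodule.Quotient.mk_eq_zero] at this

/-- A module of rank `r` has a presentation by a finite free module whose kernel has rank. -/
theorem HasFreeRank.exists_presentation [Module.Finite R C] (h : HasFreeRank R C) :
    ∃ (r m : ℕ) (p : (Fin r → R) × (Fin m → R) →ₗ[R] C), Function.Surjective p ∧
      HasFreeRank R (LinearMap.ker p) := by
  obtain ⟨r, f, σ, s, hs, hf, hfσ, hσf⟩ := h.exists_quasi_inverse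
  obtain ⟨m, g, hg⟩ := Module.Finite.exists_fin' R C
  refine ⟨r, m, f.coprod g, fun c ↦ ?_, m, ?_⟩
  · obtain ⟨v, rfl⟩ := hg c
    exact ⟨(0, v), by simp⟩
  -- The evident relation `s • g v = f (σ (g v))` supplies a free submodule of rank `m` in the
  -- kernel, and `s` multiplies the kernel into it.
  let ι : (Fin m → R) →ₗ[R] (Fin r → R) × (Fin m → R) :=
    (-(σ ∘ₗ g)).prod (LinearMap.lsmul R _ s)
  refine ⟨ι.codRestrict _ fun v ↦ ?_, fun v w hvw ↦ ?_, s, hs, ?_⟩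
  · simp [ι, hfσ]
  · have h1 : s • v = s • w := congrArg (fun x ↦ (Subtype.val x).2) hvw
    rw [← sub_eq_zero, ← smul_sub] at h1
    exact sub_eq_zero.mp (eq_zero_of_smul_eq_zero_of_mem_nonZeroDivisors hs h1)
  · rintro ⟨⟨a, v⟩, hav⟩
    refine ⟨v, Subtype.ext ?_⟩
    have h1 : g v = -f a := by
      have : f a + g v = 0 := by simpa using hav
      exact eq_neg_of_add_eq_zero_right this
    change (-(σ (g v)), s • v) = (s • a, s • v)
    rw [h1, map_neg, neg_neg, hσf]

/-- Cokernels of suitable maps to finite free modules again have rank. -/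
theorem HasFreeRank.exists_coker (h : HasFreeRank R C) :
    ∃ (r : ℕ) (σ : C →ₗ[R] (Fin r → R)), ∀ (m : ℕ) (a : C →ₗ[R] (Fin m → R)),
      HasFreeRank R (((Fin r → R) × (Fin m → R)) ⧸ LinearMap.range (σ.prod a)) := by
  obtain ⟨r, f, σ, s, hs, hf, hfσ, hσf⟩ := h.exists_quasi_inverse
  -- The free submodule is the second factor. Modulo the image of `f u`, which is `(s • u, a (f
  -- u))`, `s • (u, v)` becomes `(0, s • v - a (f u))`.
  refine ⟨r, σ, fun m a ↦ ⟨m, Submodule.mkQ _ ∘ₗ LinearMap.inr R _ _, ?_, s, hs, fun c ↦ ?_⟩⟩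
  · rw [injective_iff_map_eq_zero]
    intro v hv
    obtain ⟨x, hx⟩ := (Submodule.Quotient.mk_eq_zero _).mp hv
    have h1 : σ x = 0 := congrArg Prod.fst hx
    have h2 : a x = v := congrArg Prod.snd hx
    refine eq_zero_of_smul_eq_zero_of_mem_nonZeroDivisors hs ?_
    rw [← h2, ← map_smul, ← hfσ, h1, map_zero, map_zero]
  · obtain ⟨⟨u, v⟩, rfl⟩ := Submodule.Quotient.mk_surjective _ c
    refine ⟨s • v - a (f u), ?_⟩
    rw [← Submodule.Quotient.mk_smul]
    refine (Submodule.Quotient.eq _).mpr ⟨-f u, ?_⟩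
    simp [hσf]

/-- A torsionless module having rank embeds in a finite free module with torsion cokernel. -/
theorem HasFreeRank.exists_embedding (h : HasFreeRank R C)
    (hC : Function.Injective (Module.Dual.eval R C)) :
    ∃ (r : ℕ) (σ : C →ₗ[R] (Fin r → R)), Function.Injective σ ∧
      Module.IsTorsion R ((Fin r → R) ⧸ LinearMap.range σ) := by
  obtain ⟨r, f, σ, s, hs, hf, hfσ, hσf⟩ := h.exists_quasi_inverse
  refine ⟨r, σ, ?_, fun x ↦ ?_⟩
  · rw [injective_iff_map_eq_zero]
    intro x hx
    -- The kernel of `σ` is killed by `s`, and a torsionless module has no such elements.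
    have h1 : s • x = 0 := by rw [← hfσ, hx, map_zero]
    refine hC ?_
    ext φ
    have h2 : s * φ x = 0 := by rw [← smul_eq_mul, ← map_smul, h1, map_zero]
    simpa using (mul_left_mem_nonZeroDivisors_eq_zero_iff hs).mp h2
  · obtain ⟨x, rfl⟩ := Submodule.Quotient.mk_surjective _ x
    refine ⟨⟨s, hs⟩, ?_⟩
    change Submodule.Quotient.mk (s • x) = 0
    rw [Submodule.Quotient.mk_eq_zero]
    exact ⟨f x, hσf x⟩

end Rank

/-! ### Replacing a module of rank by a perpendicular or a torsion one. -/

section Reduction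

variable {R : Type u} [CommRing R]

theorem exists_extend_finite_free {X G : Type u} [AddCommGroup X] [Module R X] [AddCommGroup G]
    [Module R G] {a : X →ₗ[R] G} (h : ∀ φ : X →ₗ[R] R, ∃ ψ, ψ ∘ₗ a = φ) {ι κ : Type}
    (b : X →ₗ[R] (ι → R) × (κ → R)) : ∃ ψ : G →ₗ[R] (ι → R) × (κ → R), ψ ∘ₗ a = b := by
  choose ψ₁ h₁ using fun i ↦ h (LinearMap.proj i ∘ₗ LinearMap.fst R _ _ ∘ₗ b)
  choose ψ₂ h₂ using fun i ↦ h (LinearMap.proj i ∘ₗ LinearMap.snd R _ _ ∘ₗ b)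
  refine ⟨(LinearMap.pi ψ₁).prod (LinearMap.pi ψ₂), ?_⟩
  ext x i
  · exact LinearMap.congr_fun (h₁ i) x
  · exact LinearMap.congr_fun (h₂ i) x

/-- Over a ring of finite self-injective dimension, a module `C` of rank with `Ext^i(C, R) = 0` for
`i > k` can be replaced, as far as `Tor` in degrees at least `k` is concerned, by a module `X` of
rank with `Ext^i(X, R) = 0` for all `i > 0`. -/
theorem ExtVanishesAbove.exists_replacement [IsNoetherianRing R] {n : ℕ}
    (hR : FiniteSelfInjectiveDimension R n) (k : ℕ) (C : Type u) [AddCommGroup C] [Module R C]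
    (hC : ExtVanishesAbove R k C) (hrk : HasFreeRank R C) :
    ∃ (X : Type u) (_ : AddCommGroup X) (_ : Module R X), ExtVanishesAbove R 0 X ∧
      HasFreeRank R X ∧ (k = 0 → Nonempty (X ≃ₗ[R] C)) ∧
      ∀ (M : Type u) [AddCommGroup M] [Module R M],
        (∀ j, 1 ≤ j → k ≤ j → TorVanishes R M C j → TorVanishes R M X j) ∧
        (∀ j, k < j → TorVanishes R M X j → TorVanishes R M C j) := by
  induction k generalizing C with
  | zero => exact ⟨C, _, _, hC, hrk, fun _ ↦ ⟨.refl _ _⟩, fun M _ _ ↦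
      ⟨fun _ _ _ h ↦ h, fun _ _ h ↦ h⟩⟩
  | succ k ih =>
    have := hC.finite
    obtain ⟨r, m, p, hp, hker⟩ := hrk.exists_presentation
    have hinj := (LinearMap.ker p).injective_subtype
    have hexact := LinearMap.exact_subtype_ker_map p
    obtain ⟨X₁, _, _, hX₁, hrk₁, he, hTor⟩ := ih _ (hC.syzygy hinj hp hexact) hker
    obtain ⟨r', σ, hσ⟩ := hrk₁.exists_coker
    obtain ⟨m', a, ha⟩ := hX₁.exists_cosyzygy hR
    obtain ⟨hainj, hext, hX⟩ := ha r' σ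
    have hasurj := Submodule.mkQ_surjective (LinearMap.range (σ.prod a))
    have haexact := LinearMap.exact_map_mkQ_range (σ.prod a)
    refine ⟨_, _, _, hX, hσ m' a, by simp, fun M _ _ ↦ ⟨fun j _ hj h ↦ ?_, fun j hj h ↦ ?_⟩⟩
    · obtain _ | _ | j := j
      · omega
      -- Degree 1 occurs only for `k = 0`, when `X₁` is the syzygy itself. Forms extend, so its
      -- inclusion in the free cover factors through the new embedding; if the composite stays
      -- injective after `M ⊗ -`, so does the embedding.
      · obtain ⟨e⟩ := he (by omega)
        rw [zero_add, torVanishes_one_iff hinj hp hexact] at h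
        rw [zero_add, torVanishes_one_iff hainj hasurj haexact]
        obtain ⟨ψ, hψ⟩ := exists_extend_finite_free hext ((LinearMap.ker p).subtype ∘ₗ e.toLinearMap)
        refine Function.Injective.of_comp (f := ψ.lTensor M) ?_
        rw [← LinearMap.coe_comp, ← LinearMap.lTensor_comp, hψ, LinearMap.lTensor_comp,
          LinearMap.coe_comp]
        exact h.comp (e.lTensor M).injective
      · rw [torVanishes_succ_succ_iff hinj hp hexact] at h
        rw [torVanishes_succ_succ_iff hainj hasurj haexact]
        exact (hTor M).1 _ (by omega) (by omega) h
    · obtain _ | _ | j := j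
      · omega
      · omega
      · rw [torVanishes_succ_succ_iff hainj hasurj haexact] at h
        rw [torVanishes_succ_succ_iff hinj hp hexact]
        exact (hTor M).2 _ (by omega) h

variable [IsLocalRing R] [IsNoetherianRing R] {M : Type u} [AddCommGroup M] [Module R M]
  [Module.Finite R M] {d n : ℕ}

/-- Rigidity in degrees at least `d` for the maximal Cohen-Macaulay modules of rank implies it for
all modules of rank. -/
theorem torRigid_of_maximalCohenMacaulay (hR : FiniteSelfInjectiveDimension R n)
    (hd : ringKrullDim R = d)
    (h : ∀ (X : Type u) [AddCommGroup X] [Module R X], ExtVanishesAbove R 0 X → HasFreeRank R X →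
      ∀ j, 1 ≤ j → d ≤ j → TorVanishes R M X j → ∀ i, j ≤ i → TorVanishes R M X i)
    (C : Type u) [AddCommGroup C] [Module R C] [Module.Finite R C] (hC : ModuleHasRank R C)
    (j : ℕ) (hj : d ≤ j) (hTor : TorVanishes R M C j) (i : ℕ) (hi : j ≤ i) :
    TorVanishes R M C i := by
  obtain rfl | hj0 := Nat.eq_zero_or_pos j
  · exact torVanishes_of_torVanishes_zero hTor i
  -- The case `i = j` is split off because vanishing returns from `X` to `C` only in degrees
  -- strictly above `d`.
  obtain rfl | hlt := eq_or_lt_of_le hi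
  · exact hTor
  obtain ⟨X, _, _, hX, hrk, -, hT⟩ :=
    ((hR.exists_isRegular hd).1 C).exists_replacement hR d C hC.hasFreeRank
  exact (hT M).2 i (by omega) (h X hX hrk j hj0 hj ((hT M).1 j hj0 hj hTor) i hi)

/-- Rigidity in degrees at least `d` for torsion modules implies it for all modules of rank. -/
theorem torRigid_of_isTorsion (hR : FiniteSelfInjectiveDimension R n) (hd : ringKrullDim R = d)
    (h : ∀ (T : Type u) [AddCommGroup T] [Module R T] [Module.Finite R T], Module.IsTorsion R T →
      ∀ j, d ≤ j → TorVanishes R M T j → ∀ i, j ≤ i → TorVanishes R M T i)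
    (C : Type u) [AddCommGroup C] [Module R C] [Module.Finite R C] (hC : ModuleHasRank R C)
    (j : ℕ) (hj : d ≤ j) (hTor : TorVanishes R M C j) (i : ℕ) (hi : j ≤ i) :
    TorVanishes R M C i := by
  refine torRigid_of_maximalCohenMacaulay hR hd (fun X _ _ hX hrk j hj0 hj hTor i hi ↦ ?_)
    C hC j hj hTor i hi
  obtain ⟨r, σ, hσ, htors⟩ := hrk.exists_embedding (hX.eval_injective hR)
  have hsurj := Submodule.mkQ_surjective (LinearMap.range σ)
  have hexact := LinearMap.exact_map_mkQ_range σ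
  obtain ⟨j, rfl⟩ : ∃ l, j = l + 1 := ⟨j - 1, by omega⟩
  obtain ⟨i, rfl⟩ : ∃ l, i = l + 1 := ⟨i - 1, by omega⟩
  rw [← torVanishes_succ_succ_iff hσ hsurj hexact] at hTor ⊢
  exact h _ htors _ (by omega) hTor _ (by omega)

end Reduction

theorem ModuleHasRank.of_isTorsion {R : Type u} [CommRing R] {C : Type u} [AddCommGroup C]
    [Module R C] [Module.Finite R C] (h : Module.IsTorsion R C) : ModuleHasRank R C :=
  (HasFreeRank.of_isTorsion h).moduleHasRank

/-! ### Torsion, finite length and depth in dimension one. -/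

section DimensionOne

variable {R : Type u} [CommRing R] {C : Type u} [AddCommGroup C] [Module R C]

/-- A single non-zero-divisor `s` kills `C`, and `R/(s)` has dimension at most 0, hence is Artinian.
-/
theorem isFiniteLength_of_isTorsion [IsNoetherianRing R] (hd : ringKrullDim R = 1)
    [Module.Finite R C] (h : Module.IsTorsion R C) : IsFiniteLength R C := by
  obtain ⟨s, hs, hs'⟩ := Submodule.annihilator_top_inter_nonZeroDivisors h
  have hdim : Ring.KrullDimLE 0 (R ⧸ Ideal.span {s}) := by
    have h1 := ringKrullDim_quotient_succ_le_of_nonZeroDivisor hs'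
    rw [hd] at h1
    rw [Ring.KrullDimLE, Order.krullDimLE_iff]
    change ringKrullDim _ ≤ _
    revert h1
    generalize ringKrullDim (R ⧸ Ideal.span {s}) = e
    intro h1
    induction e with
    | bot => exact bot_le
    | coe e =>
      induction e with
      | top => exact absurd (WithBot.coe_le_coe.mp h1 : (⊤ : ℕ∞) + 1 ≤ 1) (by simp)
      | coe e =>
        have : e + 1 ≤ 1 := by exact_mod_cast h1
        have : e = 0 := by omega
        simp [this]
  have hart : IsArtinianRing (R ⧸ Ideal.span {s}) := isArtinianRing_iff_krullDimLE_zero.mpr hdim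
  have htors : Module.IsTorsionBySet R C (Ideal.span {s} : Ideal R) := by
    rw [Module.isTorsionBySet_span_singleton_iff]
    exact fun c ↦ Submodule.mem_annihilator.mp hs c trivial
  let _ := htors.module
  have : IsScalarTower R (R ⧸ Ideal.span {s}) C := htors.isScalarTower
  have : Module.Finite (R ⧸ Ideal.span {s}) C := Module.Finite.of_restrictScalars_finite R _ _
  have : IsArtinian (R ⧸ Ideal.span {s}) C := inferInstance
  have : IsArtinian R C :=
    isArtinian_of_surjective_algebraMap (Ideal.Quotient.mk_surjective (I := Ideal.span {s}))
  exact isFiniteLength_iff_isNoetherian_isArtinian.mpr ⟨inferInstance, this⟩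

variable [IsDomain R]

theorem moduleHasRank_of_isDomain [Module.Finite R C] : ModuleHasRank R C :=
  ⟨_, ⟨(Module.finBasis (FractionRing R) (FractionRing R ⊗[R] C)).equivFun⟩⟩

/-- A nontorsion element would embed `R` in an Artinian module, and an Artinian domain is a field.
-/
theorem isTorsion_of_isFiniteLength (hd : ringKrullDim R = 1) (h : IsFiniteLength R C) :
    Module.IsTorsion R C := by
  obtain ⟨-, hart⟩ := isFiniteLength_iff_isNoetherian_isArtinian.mp h
  intro c
  by_contra! hc
  have hinj : Function.Injective (LinearMap.toSpanSingleton R C c) := by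
    rw [injective_iff_map_eq_zero]
    intro a ha
    by_contra ha0
    exact hc ⟨a, mem_nonZeroDivisors_of_ne_zero ha0⟩ ha
  have : IsArtinianRing R := isArtinian_of_injective _ hinj
  have := ringKrullDim_eq_zero_of_isField (IsArtinianRing.isField_of_isDomain R)
  rw [hd] at this
  exact one_ne_zero this

variable [IsLocalRing R]

theorem isMaximalCohenMacaulay_of_torsion_eq_bot [IsNoetherianRing R]
    (hd : ringKrullDim R = 1) [Module.Finite R C]
    (h : Submodule.torsion R C = ⊥) : IsMaximalCohenMacaulay R C := by
  refine ⟨inferInstance, or_iff_not_imp_left.mpr fun hns ↦ ?_⟩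
  have : Nontrivial C := not_subsingleton_iff_nontrivial.mp hns
  obtain ⟨x, hx, hx0⟩ : ∃ x ∈ IsLocalRing.maximalIdeal R, x ≠ 0 := by
    refine Submodule.exists_mem_ne_zero_of_ne_bot fun hbot ↦ ?_
    have := ringKrullDim_eq_zero_of_isField (IsLocalRing.isField_iff_maximalIdeal_eq.mpr hbot)
    rw [hd] at this
    exact one_ne_zero this
  have hmem : ∀ y ∈ [x], y ∈ IsLocalRing.maximalIdeal R := by simpa using hx
  have hreg : RingTheory.Sequence.IsRegular C [x] := by
    rw [IsLocalRing.isRegular_iff_isWeaklyRegular_of_subset_maximalIdeal hmem,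
      RingTheory.Sequence.isWeaklyRegular_singleton_iff, isSMulRegular_iff_right_eq_zero_of_smul]
    intro c hc
    have : c ∈ Submodule.torsion R C := ⟨⟨x, mem_nonZeroDivisors_of_ne_zero hx0⟩, hc⟩
    rwa [h, Submodule.mem_bot] at this
  have : moduleDepth R C = 1 := by
    refine le_antisymm ?_ ?_
    · exact iSup_le fun rs ↦ iSup_le fun _ ↦ iSup_le fun h ↦
        by exact_mod_cast length_le_of_isRegular (d := 1) (by exact_mod_cast hd) h
    · exact le_iSup_of_le [x] (le_iSup_of_le hmem (le_iSup_of_le hreg (by simp)))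
  rw [this, hd]
  rfl

/-- Depth one yields an `x` in the maximal ideal regular on `C`. If `a ≠ 0` kills `c`, then a power
of `x` lies in `(a)`, the maximal ideal being the only nonzero prime, and so `c = 0`. -/
theorem IsMaximalCohenMacaulay.torsion_eq_bot (hd : ringKrullDim R = 1)
    (h : IsMaximalCohenMacaulay R C) : Submodule.torsion R C = ⊥ := by
  obtain ⟨hfin, hsub | hdepth⟩ := h
  · exact Subsingleton.elim _ _
  rw [hd] at hdepth
  have hdepth : moduleDepth R C = 1 := by exact_mod_cast hdepth
  obtain ⟨x, hx, hreg⟩ : ∃ x ∈ IsLocalRing.maximalIdeal R, IsSMulRegular C x := by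
    by_contra! hcon
    refine one_ne_zero (hdepth.symm.trans (le_antisymm ?_ zero_le))
    refine iSup_le fun rs ↦ iSup_le fun hmem ↦ iSup_le fun hreg ↦ ?_
    obtain _ | ⟨x, rs⟩ := rs
    · simp
    · exact absurd ((RingTheory.Sequence.isRegular_cons_iff C x rs).mp hreg).1
        (hcon x (hmem x (by simp)))
  rw [eq_bot_iff]
  rintro c ⟨⟨a, ha⟩, hac⟩
  have hac : a • c = 0 := hac
  have hrad : x ∈ (Ideal.span {a}).radical := by
    rw [Ideal.radical_eq_sInf, Submodule.mem_sInf]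
    rintro P ⟨hP, hprime⟩
    have hPbot : P ≠ ⊥ := fun hbot ↦ nonZeroDivisors.ne_zero ha
      (by simpa [hbot] using hP (Ideal.mem_span_singleton_self a))
    have hle : Ring.KrullDimLE 1 R := by
      rw [Ring.KrullDimLE, Order.krullDimLE_iff]
      exact hd.le
    have := Ring.krullDimLE_one_iff_of_isPrime_bot.mp hle P hPbot hprime
    rwa [IsLocalRing.eq_maximalIdeal this]
  obtain ⟨k, hk⟩ := hrad
  obtain ⟨b, hb⟩ := Ideal.mem_span_singleton'.mp hk
  refine (Submodule.mem_bot R).mpr ((hreg.pow k).right_eq_zero_of_smul ?_)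
  rw [← hb, mul_smul, hac, smul_zero]

end DimensionOne

/-! ### Assembling the equivalences. -/

theorem mainTheorem12 {R : Type u} [CommRing R] [IsLocalRing R] (hR : IsGorensteinLocalRing R)
    (d : ℕ) (hd : ringKrullDim R = d)
    (M : Type u) [AddCommGroup M] [Module R M] [Module.Finite R M] :
    List.TFAE [
      ∀ (C : Type u) [AddCommGroup C] [Module R C] [Module.Finite R C],
        Module.IsTorsion R C →
          ∀ n : ℕ, d ≤ n → TorVanishes R M C n → ∀ i : ℕ, n ≤ i → TorVanishes R M C i,
      ∀ (C : Type u) [AddCommGroup C] [Module R C] [Module.Finite R C],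
        IsMaximalCohenMacaulay R C → ModuleHasRank R C →
          ∀ n : ℕ, d ≤ n → TorVanishes R M C n → ∀ i : ℕ, n ≤ i → TorVanishes R M C i,
      ∀ (C : Type u) [AddCommGroup C] [Module R C] [Module.Finite R C],
        ModuleHasRank R C →
          ∀ n : ℕ, d ≤ n → TorVanishes R M C n → ∀ i : ℕ, n ≤ i → TorVanishes R M C i] ∧
    (d = 1 → IsDomain R →
      (∀ (C : Type u) [AddCommGroup C] [Module R C] [Module.Finite R C],
        Module.IsTorsion R C ↔ IsFiniteLength R C) ∧
      (∀ (C : Type u) [AddCommGroup C] [Module R C] [Module.Finite R C],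
        Submodule.torsion R C = ⊥ ↔ IsMaximalCohenMacaulay R C) ∧
      List.TFAE [
        IsTorRigid R M,
        ∀ (C : Type u) [AddCommGroup C] [Module R C] [Module.Finite R C],
          Module.IsTorsion R C → IsTorRigidPair R 1 M C,
        ∀ (C : Type u) [AddCommGroup C] [Module R C] [Module.Finite R C],
          Submodule.torsion R C = ⊥ → IsTorRigidPair R 1 M C]) := by
  have hN : IsNoetherianRing R := hR.1
  obtain ⟨n, hinj⟩ := hR.exists_finiteSelfInjectiveDimension
  -- The extra `1 ≤ n` weakens what is asked of maximal Cohen–Macaulay modules, so the same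
  -- reduction serves both the proposition and the corollary.
  have of_mcm (h : ∀ (C : Type u) [AddCommGroup C] [Module R C] [Module.Finite R C],
      IsMaximalCohenMacaulay R C → ModuleHasRank R C → ∀ n : ℕ, 1 ≤ n → d ≤ n →
        TorVanishes R M C n → ∀ i : ℕ, n ≤ i → TorVanishes R M C i) :
      ∀ (C : Type u) [AddCommGroup C] [Module R C] [Module.Finite R C], ModuleHasRank R C →
        ∀ n : ℕ, d ≤ n → TorVanishes R M C n → ∀ i : ℕ, n ≤ i → TorVanishes R M C i :=
    torRigid_of_maximalCohenMacaulay hinj hd fun X _ _ hX hrk ↦ by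
      have := hX.finite
      exact h X (hX.isMaximalCohenMacaulay hinj hd) hrk.moduleHasRank
  refine ⟨?_, fun hd1 hdom ↦ ?_⟩
  · tfae_have 1 → 3 := fun h ↦ torRigid_of_isTorsion hinj hd h
    tfae_have 3 → 1 := fun h C _ _ _ hC ↦ h C (.of_isTorsion hC)
    tfae_have 3 → 2 := fun h C _ _ _ _ hC ↦ h C hC
    tfae_have 2 → 3 := fun h ↦ of_mcm fun C _ _ _ hC hrk n _ ↦ h C hC hrk n
    tfae_finish
  subst hd1
  have hd' : ringKrullDim R = 1 := by exact_mod_cast hd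
  have pair_iff (C : Type u) [AddCommGroup C] [Module R C] : IsTorRigidPair R 1 M C ↔
      ∀ n : ℕ, 1 ≤ n → TorVanishes R M C n → ∀ i : ℕ, n ≤ i → TorVanishes R M C i := by
    refine forall₂_congr fun r _ ↦ imp_congr_left ⟨fun h ↦ h r le_rfl (by omega), fun h i h1 h2 ↦ ?_⟩
    obtain rfl : i = r := by omega
    exact h
  refine ⟨fun C _ _ _ ↦ ⟨isFiniteLength_of_isTorsion hd', isTorsion_of_isFiniteLength hd'⟩,
    fun C _ _ _ ↦ ⟨isMaximalCohenMacaulay_of_torsion_eq_bot hd', fun h ↦ h.torsion_eq_bot hd'⟩, ?_⟩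
  tfae_have 1 → 2 := fun h C _ _ _ _ ↦ h C
  tfae_have 1 → 3 := fun h C _ _ _ _ ↦ h C
  tfae_have 2 → 1 := fun h C _ _ _ ↦ (pair_iff C).mpr
    (torRigid_of_isTorsion hinj hd (fun T _ _ _ hT ↦ (pair_iff T).mp (h T hT)) C
      moduleHasRank_of_isDomain)
  tfae_have 3 → 1 := fun h C _ _ _ ↦ (pair_iff C).mpr
    (of_mcm (fun C _ _ _ hC _ n _ hn ↦ (pair_iff C).mp (h C (hC.torsion_eq_bot hd')) n hn) C
      moduleHasRank_of_isDomain)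
  tfae_finish
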